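/- A polymatroid $\mathsf M=(E,\mathrm{rk})$ consists of a finite set $E$ and a function $\mathrm{rk}\colon 2^E\to\mathbb Z_{\ge 0}$ with $\mathrm{rk}(\varnothing)=0$ that is monotone under inclusion and satisfies $\mathrm{rk}(A)+\mathrm{rk}(B)\ge \mathrm{rk}(A\cup B)+\mathrm{rk}(A\cap B)$. A flat is a subset $F\subseteq E$ with $\mathrm{rk}(F\cup\{e\})>\mathrm{rk}(F)$ for all $e\in E\setminus F$; the flats, ordered by inclusion, form a lattice $\mathcal L(\mathsf M)$. The polymatroid is loopless if $\varnothing$ is a flat. Its characteristic polynomial is $\chi_{\mathsf M}(x)=\sum_{F\in\mathcal L(\mathsf M)}\mu(\varnothing,F)\,x^{\mathrm{rk}(E)-\mathrm{rk}(F)}$, where $\mu$ is the Möbius function of $\mathcal L(\mathsf M)$. For a flat $F$, the restriction is $\mathsf M|_F=(F,\mathrm{rk})$ and the contraction is $\mathsf M/F=(E\setminus F,\ A\mapsto \mathrm{rk}(A\cup F)-\mathrm{rk}(F))$; the flats of $\mathsf M/F$ correspond to the flats of $\mathsf M$ containing $F$, via $A\mapsto A\cup F$. For a set $\mathcal G$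 of flats let $f(\mathcal G)$ be the set of its maximal elements and $\mathcal G_{\le F}=\{G\in\mathcal G: G\subseteq F\}$. A set $\mathcal G$ of nonempty flats is a building set if, for every flat $F$, the map $\prod_{G\in f(\mathcal G_{\le F})}[\varnothing,G]\to[\varnothing,F]$, $(y_G)_G\mapsto\bigvee_G y_G$, is an isomorphism of lattices and $\mathrm{rk}(F)=\sum_{G\in f(\mathcal G_{\le F})}\mathrm{rk}(G)$. For a flat $F$ put $\mathcal G|_F=\mathcal G_{\le F}\subseteq\mathcal L(\mathsf M|_F)$ and $\mathcal G/F=\{G\vee F: G\in\mathcal G,\ G\not\subseteq F\}$, a set of flats of $\mathsf M/F$ under the above correspondence. The Chow ring $D(\mathsf M,\mathcal G)$ is the graded quotient of $\mathbb Q[x_G:G\in\mathcal G]$ by the ideal generated by $$\Big(\prod_{G'\in S}x_{G'}\Big)\Big(\sum_{H\in\mathcal G,\,H\supseteq G}x_H\Big)^{\mathrm{rk}(G)-\mathrm{rk}(\sup(S,G))}\qquad (S\subseteq\mathcal G,\ G\in\mathcal G),$$ where $\sup(S,G)=\bigvee_{G'\in S,\,G'\subsetneq G}G'$. Its Hilbert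 series is $\mathrm H_{\mathsf M}^{\mathcal G}(x)=\sum_{i\ge0}\dim_{\mathbb Q}D^i(\mathsf M,\mathcal G)\,x^i$. **Corollary.** For every loopless polymatroid $\mathsf M$ on $E$ and every building set $\mathcal G$ of $\mathsf M$, $$\mathrm H_{\mathsf M}^{\mathcal G}(x)=\sum_{m\ge0}\ \sum_{\varnothing=F_0\subsetneq F_1\subsetneq\cdots\subsetneq F_m=E}(-1)^m\prod_{i=1}^m\frac{\chi_{\mathsf M|_{F_i}/F_{i-1}}(x)}{(1-x)^{|f(\mathcal G|_{F_i}/F_{i-1})|}},$$ where the inner sum runs over all chains of flats of $\mathsf M$ from $\varnothing$ to $E$. -/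

import Mathlib

open scoped BigOperators

/-- A polymatroid on a finite ground set `ground ⊆ α`. Only the values of `rk` on subsets of the
ground set carry information. -/
structure Polymatroid (α : Type*) [DecidableEq α] where
  ground : Finset α
  rk : Finset α → ℕ
  rk_empty : rk ∅ = 0
  rk_mono : ∀ A B : Finset α, A ⊆ B → B ⊆ ground → rk A ≤ rk B
  rk_submod : ∀ A B : Finset α, A ⊆ ground → B ⊆ ground → rk (A ∪ B) + rk (A ∩ B) ≤ rk A + rk B

namespace Polymatroid

variable {α : Type*} [DecidableEq α]

/-- Flats: subsets of the ground set whose rank strictly grows when any further element is added. -/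
structure IsFlat (M : Polymatroid α) (F : Finset α) : Prop where
  subset_ground : F ⊆ M.ground
  rk_lt : ∀ e ∈ M.ground \ F, M.rk F < M.rk (insert e F)

def Loopless (M : Polymatroid α) : Prop := M.IsFlat ∅

/-- The lattice of flats, ordered by inclusion. -/
def Flat (M : Polymatroid α) : Type _ := {F : Finset α // M.IsFlat F}

namespace Flat

variable {M : Polymatroid α}

/-- The underlying subset of the ground set. -/
def set (F : M.Flat) : Finset α := F.1

instance : PartialOrder M.Flat := inferInstanceAs (PartialOrder {F : Finset α // M.IsFlat F})

theorem le_iff {F G : M.Flat} : F ≤ G ↔ F.set ⊆ G.set := Iff.rfl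

theorem subset_ground (F : M.Flat) : F.set ⊆ M.ground := F.2.subset_ground

end Flat

/-- If `A ⊆ F ⊆ E` and adding `e` raises the rank of `F`, then it raises the rank of `A`. -/
theorem rk_lt_insert_of_subset (M : Polymatroid α) {A F : Finset α} {e : α} (hAF : A ⊆ F)
    (hF : F ⊆ M.ground) (he : e ∈ M.ground) (h : M.rk F < M.rk (insert e F)) (heF : e ∉ F) :
    M.rk A < M.rk (insert e A) := by
  have h1 := M.rk_submod (insert e A) F
    (Finset.insert_subset he (hAF.trans hF)) hF
  have h2 : insert e A ∪ F = insert e F := by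
    rw [Finset.insert_union, Finset.union_eq_right.2 hAF]
  have h3 : insert e A ∩ F = A := by
    rw [Finset.insert_inter_of_notMem heF, Finset.inter_eq_left.2 hAF]
  rw [h2, h3] at h1
  omega

open Classical in
/-- The meet of a family of flats is its intersection (inside the ground set). -/
noncomputable instance (M : Polymatroid α) : InfSet M.Flat where
  sInf s := ⟨M.ground.filter (fun e => ∀ F ∈ s, e ∈ F.set),
    Finset.filter_subset _ _, by
      intro e he
      rw [Finset.mem_sdiff, Finset.mem_filter] at he
      obtain ⟨he, h⟩ := he
      have h' : ∃ F ∈ s, e ∉ F.set := by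
        by_contra hcon
        push Not at hcon
        exact h ⟨he, hcon⟩
      obtain ⟨F, hF, heF⟩ := h'
      exact M.rk_lt_insert_of_subset (fun x hx => (Finset.mem_filter.1 hx).2 F hF)
        F.subset_ground he (F.2.rk_lt e (Finset.mem_sdiff.2 ⟨he, heF⟩)) heF⟩

/-- The flats form a (complete) lattice under inclusion; joins are least upper bounds. -/
noncomputable instance (M : Polymatroid α) : CompleteLattice M.Flat :=
  completeLatticeOfInf M.Flat (by
    classical
    intro s
    constructor
    · intro F hF x hx
      exact (Finset.mem_filter.1 hx).2 F hF
    · intro G hG x hx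
      exact Finset.mem_filter.2 ⟨G.subset_ground hx, fun F hF => hG hF hx⟩)

instance (M : Polymatroid α) : Finite M.Flat :=
  Finite.of_injective
    (fun F : M.Flat => (⟨F.set, Finset.mem_powerset.2 F.subset_ground⟩ : M.ground.powerset))
    (fun _ _ h => Subtype.ext (congrArg (fun z => z.1) h))

noncomputable instance (M : Polymatroid α) : Fintype M.Flat := Fintype.ofFinite _

open Classical in
noncomputable instance (M : Polymatroid α) : LocallyFiniteOrder M.Flat :=
  Fintype.toLocallyFiniteOrder

/-! ### Restriction and contraction -/

/-- The restriction `M|_F` to a flat `F`. -/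
def restrict (M : Polymatroid α) (F : M.Flat) : Polymatroid α where
  ground := F.set
  rk := M.rk
  rk_empty := M.rk_empty
  rk_mono A B hAB hB := M.rk_mono A B hAB (hB.trans F.subset_ground)
  rk_submod A B hA hB :=
    M.rk_submod A B (hA.trans F.subset_ground) (hB.trans F.subset_ground)

/-- The contraction `M/F` by a flat `F`, with rank function `A ↦ rk (A ∪ F) - rk F`. -/
def contract (M : Polymatroid α) (F : M.Flat) : Polymatroid α where
  ground := M.ground \ F.set
  rk A := M.rk (A ∪ F.set) - M.rk F.set
  rk_empty := by simp
  rk_mono A B hAB hB := Nat.sub_le_sub_right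
    (M.rk_mono _ _ (Finset.union_subset_union_left hAB)
      (Finset.union_subset (hB.trans Finset.sdiff_subset) F.subset_ground)) _
  rk_submod A B hA hB := by
    have hA' := Finset.union_subset (hA.trans Finset.sdiff_subset) F.subset_ground
    have hB' := Finset.union_subset (hB.trans Finset.sdiff_subset) F.subset_ground
    have h := M.rk_submod (A ∪ F.set) (B ∪ F.set) hA' hB'
    rw [← Finset.union_union_distrib_right, ← Finset.inter_union_distrib_right] at h
    have h1 := M.rk_mono F.set (A ∩ B ∪ F.set) Finset.subset_union_right
      ((Finset.union_subset_union_left Finset.inter_subset_left).trans hA')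
    have h2 := M.rk_mono F.set (A ∪ F.set) Finset.subset_union_right hA'
    have h3 := M.rk_mono F.set (B ∪ F.set) Finset.subset_union_right hB'
    have h4 := M.rk_mono F.set (A ∪ B ∪ F.set) Finset.subset_union_right
      (by rw [Finset.union_union_distrib_right]; exact Finset.union_subset hA' hB')
    omega

/-- A flat `F ⊆ G`, regarded as a flat of the restriction `M|_G`. -/
def Flat.toRestrict {M : Polymatroid α} (F G : M.Flat) (h : F ≤ G) : (M.restrict G).Flat :=
  ⟨F.set, h, fun e he => F.2.rk_lt e (Finset.sdiff_subset_sdiff G.subset_ground subset_rfl he)⟩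

/-- The minor `M|_G/F` for flats `F ⊆ G`. -/
def minor (M : Polymatroid α) (F G : M.Flat) (h : F ≤ G) : Polymatroid α :=
  (M.restrict G).contract (F.toRestrict G h)

/-! ### Building sets -/

/-- The set `f(𝒢)` of `𝒢`-factors: the maximal elements of `𝒢`. -/
def factors {M : Polymatroid α} (𝒢 : Set M.Flat) : Set M.Flat := {G | Maximal (· ∈ 𝒢) G}

/-- The set `𝒢_{≤ F}`. -/
def below {M : Polymatroid α} (𝒢 : Set M.Flat) (F : M.Flat) : Set M.Flat := {G ∈ 𝒢 | G ≤ F}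

open Classical in
/-- Building sets. Here `Set.Iic G` is the interval `[∅, G]`, and the map
`∏_{G ∈ f(𝒢_{≤ F})} [∅, G] → [∅, F]` induced by the inclusions is `y ↦ ⋁_G y_G`. -/
structure IsBuildingSet (M : Polymatroid α) (𝒢 : Set M.Flat) : Prop where
  nonempty : ∀ G ∈ 𝒢, G.set.Nonempty
  factor_iso : ∀ F : M.Flat,
    ∃ φ : ((G : factors (below 𝒢 F)) → Set.Iic G.1) ≃o Set.Iic F,
      ∀ y, (φ y : M.Flat) = ⨆ G, (y G : M.Flat)
  rk_eq : ∀ F : M.Flat, M.rk F.set = ∑ G : factors (below 𝒢 F), M.rk G.1.set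

/-- The induced collection `𝒢|_F = {G ∈ 𝒢 : G ⊆ F}` of flats of `M|_F`. -/
def restrictBuilding {M : Polymatroid α} (𝒢 : Set M.Flat) (F : M.Flat) :
    Set (M.restrict F).Flat :=
  {G' | ∃ G ∈ 𝒢, G ≤ F ∧ G'.set = G.set}

/-- The induced collection `𝒢/F = {G ∨ F : G ∈ 𝒢, G ⊄ F}` of flats of `M/F`. A flat `H ⊇ F` of `M`
corresponds to the flat `H \ F` of `M/F`. -/
def contractBuilding {M : Polymatroid α} (𝒢 : Set M.Flat) (F : M.Flat) :
    Set (M.contract F).Flat :=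
  {G' | ∃ G ∈ 𝒢, ¬ G ≤ F ∧ G'.set = (G ⊔ F).set \ F.set}

/-- The induced collection `𝒢|_G/F` of flats of the minor `M|_G/F`. -/
def minorBuilding {M : Polymatroid α} (𝒢 : Set M.Flat) (F G : M.Flat) (h : F ≤ G) :
    Set (M.minor F G h).Flat :=
  contractBuilding (restrictBuilding 𝒢 G) (F.toRestrict G h)

/-! ### Characteristic polynomial -/

open Classical in
/-- `χ_M(x) = ∑_F μ(∅, F) x^{rk E - rk F}`, the sum being over all flats; `⊥` is the least flat,
which is `∅` when `M` is loopless. -/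
noncomputable def charPoly (M : Polymatroid α) : Polynomial ℚ :=
  ∑ F : M.Flat, Polynomial.C (IncidenceAlgebra.mu ℚ (⊥ : M.Flat) F) *
    Polynomial.X ^ (M.rk M.ground - M.rk F.set)

/-! ### The Chow ring and its Hilbert series -/

/-- `sup(S, G)`: the join of all elements of `S` strictly below `G`. -/
noncomputable def supBelow {M : Polymatroid α} {𝒢 : Set M.Flat} (S : Finset 𝒢) (G : 𝒢) : M.Flat :=
  ⨆ G' ∈ {G' : 𝒢 | G' ∈ S ∧ G' < G}, (G' : M.Flat)

open Classical in
/-- The generator `(∏_{G' ∈ S} x_{G'}) (∑_{H ≥ G} x_H)^{rk G - rk sup(S, G)}`. -/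
noncomputable def chowRelation (M : Polymatroid α) (𝒢 : Set M.Flat) (S : Finset 𝒢) (G : 𝒢) :
    MvPolynomial 𝒢 ℚ :=
  (∏ G' ∈ S, MvPolynomial.X G') *
    (∑ H : 𝒢 with G ≤ H, MvPolynomial.X H) ^ (M.rk G.1.set - M.rk (supBelow S G).set)

noncomputable def chowIdeal (M : Polymatroid α) (𝒢 : Set M.Flat) : Ideal (MvPolynomial 𝒢 ℚ) :=
  Ideal.span (Set.range fun p : Finset 𝒢 × 𝒢 => chowRelation M 𝒢 p.1 p.2)

/-- The Chow ring `D(M, 𝒢)`. -/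
abbrev ChowRing (M : Polymatroid α) (𝒢 : Set M.Flat) : Type _ :=
  MvPolynomial 𝒢 ℚ ⧸ chowIdeal M 𝒢

/-- The graded piece `D^i(M, 𝒢)`: classes of homogeneous polynomials of degree `i`. -/
noncomputable def chowPiece (M : Polymatroid α) (𝒢 : Set M.Flat) (i : ℕ) :
    Submodule ℚ (ChowRing M 𝒢) :=
  (MvPolynomial.homogeneousSubmodule 𝒢 ℚ i).map
    (Ideal.Quotient.mkₐ ℚ (chowIdeal M 𝒢)).toLinearMap

/-- The Hilbert series `H_M^𝒢(x) = ∑_{i ≥ 0} dim D^i(M, 𝒢) x^i`. The pieces are finite dimensional,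
since there are finitely many variables. -/
noncomputable def hilbertSeries (M : Polymatroid α) (𝒢 : Set M.Flat) : PowerSeries ℚ :=
  PowerSeries.mk fun i => (Module.finrank ℚ (chowPiece M 𝒢 i) : ℚ)

/-! ### Chains of flats -/

/-- Chains `∅ = F₀ ⊊ F₁ ⊊ ⋯ ⊊ Fₘ = E` of flats. -/
def FlatChain (M : Polymatroid α) (m : ℕ) : Type _ :=
  {F : Fin (m + 1) → M.Flat //
    StrictMono F ∧ (F 0).set = ∅ ∧ (F (Fin.last m)).set = M.ground}

instance (M : Polymatroid α) (m : ℕ) : Finite (M.FlatChain m) :=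
  inferInstanceAs (Finite {F : Fin (m + 1) → M.Flat //
    StrictMono F ∧ (F 0).set = ∅ ∧ (F (Fin.last m)).set = M.ground})

noncomputable instance (M : Polymatroid α) (m : ℕ) : Fintype (M.FlatChain m) := Fintype.ofFinite _

/-- Two consecutive members `Fᵢ ⊆ Fᵢ₊₁` of a chain. -/
theorem FlatChain.step_le {M : Polymatroid α} {m : ℕ} (c : M.FlatChain m) (i : Fin m) :
    c.1 i.castSucc ≤ c.1 i.succ :=
  c.2.1.monotone i.castSucc_le_succ

/-- The factor `χ_{M|_G/F}(x) / (1 - x)^{|f(𝒢|_G/F)|}` of an interval `F ⊆ G`, as a power series;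
`1 - x` is invertible there. -/
noncomputable def intervalTerm (M : Polymatroid α) (𝒢 : Set M.Flat) (F G : M.Flat) (h : F ≤ G) :
    PowerSeries ℚ :=
  ((M.minor F G h).charPoly : PowerSeries ℚ) *
    ((1 - PowerSeries.X) ^ (factors (minorBuilding 𝒢 F G h)).ncard)⁻¹

end Polymatroid

/-! ### A basis of a quotient of a polynomial ring -/

/-! Put κ(F,E) = χ(x)/(1-x)^n, with χ taken on the interval [F,E] and n the number of factors of E
not below F. By `charPoly_minor` and `ncard_factors_minorBuilding` these are the terms of the
formula, so the alternating sum over chains is an entry of the inverse of κ in the incidence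
algebra. By `eq_sum_chainSum` it suffices to find H with H(⊥) = 1, with ∑_{F ≤ E} H(F) κ(F,E) = 0
for E ≠ ⊥, and with H(⊤) the Hilbert series.

Such an H counts standard monomials: H(F) sums, over sets S of members of 𝒢 below F, the products
over G ∈ S of x + ⋯ + x^(d-1), where d is the rank of G minus that of sup(S,G); S counts only if all
such differences, over G ∈ 𝒢, are positive. That H(⊤) is the Hilbert series follows by removing the
members in order of increasing rank. Over the ring A of the remaining variables, a member K of least
rank contributes a variable X and the relations P, X·Q and (X+c)^m. Here P and Q are the relations
among the remaining members, with K counted in the joins for Q only. Since c^m Q ⊆ P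
(`upperSum_pow_mul_mem`), the quotient is A/P together with X^j A/Q for 0 < j < m, as in a blow-up
formula (`isBasisMod_blowupFamily`).

For the recursion, multiply by (1-x)^|f(E)| and expand the remaining power of 1-x over sets T of
factors of E. Möbius inversion collapses the sum over F to one power of x, determined by the rank of
the join of S and T. Putting a fixed factor K of E into or out of S and T gives four terms that
cancel, because the rank splits along the factors and (1-x)(x + ⋯ + x^(d-1)) = x - x^d
(`sum_supportSeries_eq_zero`). -/

/-- The family `b` is a basis of `A` modulo the ideal `I`. -/
structure IsBasisMod {A ι : Type*} [CommRing A] [Algebra ℚ A] [Fintype ι] (I : Ideal A)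
    (b : ι → A) : Prop where
  indep : ∀ c : ι → ℚ, ∑ i, c i • b i ∈ I → c = 0
  span : ∀ p : A, ∃ c : ι → ℚ, p - ∑ i, c i • b i ∈ I

/-! ### The blow-up formula over a polynomial ring in one variable. -/

namespace Polynomial

/-- The ideal of polynomials with constant coefficient in `P` and other coefficients in `Q`. -/
def coeffIdeal {A : Type*} [CommRing A] (P Q : Ideal A) : Ideal (Polynomial A) where
  -- The constant coefficient must lie in `Q` as well: without `P ≤ Q`, the set would not be closed
  -- under multiplication.
  carrier := {f | f.coeff 0 ∈ P ∧ ∀ n, f.coeff n ∈ Q}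
  zero_mem' := by simp
  add_mem' {f g} hf hg := ⟨by simpa using P.add_mem hf.1 hg.1,
    fun n => by simpa using Q.add_mem (hf.2 n) (hg.2 n)⟩
  smul_mem' g f hf := by
    refine ⟨?_, fun n => ?_⟩
    · rw [smul_eq_mul, mul_coeff_zero]
      exact P.mul_mem_left _ hf.1
    · rw [smul_eq_mul, coeff_mul]
      exact Q.sum_mem fun x _ => Q.mul_mem_left _ (hf.2 _)

theorem degree_X_add_C_pow {A : Type*} [CommRing A] [Nontrivial A] (c : A) (r : ℕ) :
    ((X + C c) ^ r : Polynomial A).degree = r := by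
  rw [degree_pow' (by simp), degree_X_add_C, nsmul_eq_mul, mul_one]

/-- If `c ^ r • Q ⊆ P`, the polynomials of degree less than `r` in the ideal generated by
`coeffIdeal P Q` and `(X + c) ^ r` already lie in `coeffIdeal P Q`. -/
theorem mem_coeffIdeal_of_degree_lt {A : Type*} [CommRing A] {P Q : Ideal A} {c : A}
    {r : ℕ} (hc : ∀ q ∈ Q, c ^ r * q ∈ P) {f : Polynomial A}
    (hf : f ∈ coeffIdeal P Q ⊔ Ideal.span {(X + C c) ^ r}) (hdeg : f.degree < r) :
    f ∈ coeffIdeal P Q := by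
  obtain ⟨p, hp, q, hq, rfl⟩ := Submodule.mem_sup.1 hf
  obtain ⟨g, rfl⟩ := Ideal.mem_span_singleton'.1 hq
  refine Ideal.add_mem _ hp ?_
  -- Modulo `Q` the summand `p` vanishes and `(X + c) ^ r` stays monic of degree `r`, so a nonzero
  -- `g` would make the degree at least `r`.
  have hg : g.map (Ideal.Quotient.mk Q) = 0 := by
    have hp0 : p.map (Ideal.Quotient.mk Q) = 0 := by
      ext n
      simpa using Ideal.Quotient.eq_zero_iff_mem.2 (hp.2 n)
    have hlt := (degree_map_le (f := Ideal.Quotient.mk Q)).trans_lt hdeg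
    rw [Polynomial.map_add, hp0, zero_add, Polynomial.map_mul] at hlt
    by_contra hne
    have hmon : (((X + C c) ^ r : Polynomial A).map (Ideal.Quotient.mk Q)).Monic :=
      ((monic_X_add_C c).pow r).map _
    have hnt : Nontrivial (A ⧸ Q) := by
      by_contra h
      rw [not_nontrivial_iff_subsingleton] at h
      exact hne (Subsingleton.elim _ _)
    rw [hmon.degree_mul, Polynomial.map_pow, Polynomial.map_add, map_X, map_C,
      degree_X_add_C_pow] at hlt
    have h0 : (0 : WithBot ℕ) ≤ (g.map (Ideal.Quotient.mk Q)).degree := zero_le_degree_iff.2 hne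
    have := (add_le_add_left h0 (r : WithBot ℕ)).trans_lt hlt
    simp at this
  have hgc : ∀ n, g.coeff n ∈ Q := fun n => by
    rw [← Ideal.Quotient.eq_zero_iff_mem, ← coeff_map, hg, coeff_zero]
  refine ⟨?_, fun n => ?_⟩
  · rw [mul_comm, mul_coeff_zero]
    have : ((X + C c) ^ r : Polynomial A).coeff 0 = c ^ r := by
      rw [coeff_zero_eq_eval_zero]; simp
    rw [this]
    exact hc _ (hgc 0)
  · rw [coeff_mul]
    exact Q.sum_mem fun x _ => Q.mul_mem_right _ (hgc _)

/-- The blow-up basis: constants from a basis modulo `P`, and `X ^ j` (`0 < j < r`) times a basis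
modulo `Q`. -/
noncomputable def blowupFamily {A ι κ : Type*} [CommRing A] (b : ι → A) (e : κ → A) (r : ℕ) :
    ι ⊕ (Fin (r - 1) × κ) → Polynomial A :=
  Sum.elim (fun i => C (b i)) fun p => C (e p.2) * X ^ (p.1.1 + 1)

theorem coeff_zero_blowupFamily {A ι κ : Type*} [CommRing A] [Algebra ℚ A] [Fintype ι] [Fintype κ]
    (b : ι → A) (e : κ → A) (r : ℕ) (a : ι ⊕ (Fin (r - 1) × κ) → ℚ) :
    (∑ i, a i • blowupFamily b e r i).coeff 0 = ∑ i, a (Sum.inl i) • b i := by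
  simp [blowupFamily, Fintype.sum_sum_type]

theorem coeff_succ_blowupFamily {A ι κ : Type*} [CommRing A] [Algebra ℚ A] [Fintype ι] [Fintype κ]
    (b : ι → A) (e : κ → A) (r : ℕ) (a : ι ⊕ (Fin (r - 1) × κ) → ℚ) (j : Fin (r - 1)) :
    (∑ i, a i • blowupFamily b e r i).coeff (j + 1) = ∑ k, a (Sum.inr (j, k)) • e k := by
  simp only [blowupFamily, Fintype.sum_sum_type, finsetSum_coeff, Fintype.sum_prod_type,
    Sum.elim_inl, Sum.elim_inr, coeff_add, coeff_smul, coeff_C_succ, smul_zero,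
    Finset.sum_const_zero, zero_add, coeff_C_mul, coeff_X_pow]
  rw [Finset.sum_eq_single j]
  · simp
  · intro i _ hij
    refine Finset.sum_eq_zero fun k _ => ?_
    rw [if_neg (by simpa [Fin.ext_iff] using hij.symm)]
    simp
  · simp

theorem degree_blowupFamily_lt {A ι κ : Type*} [CommRing A] [Algebra ℚ A] [Fintype ι] [Fintype κ]
    (b : ι → A) (e : κ → A) {r : ℕ} (hr : 0 < r) (a : ι ⊕ (Fin (r - 1) × κ) → ℚ) :
    (∑ i, a i • blowupFamily b e r i).degree < r := by
  refine (degree_lt_iff_coeff_zero _ _).2 fun m hm => ?_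
  rw [finsetSum_coeff]
  refine Finset.sum_eq_zero fun i _ => ?_
  rcases i with i | ⟨j, k⟩
  · simp [blowupFamily, coeff_C, show m ≠ 0 by omega]
  · simp [blowupFamily, coeff_X_pow, show m ≠ j + 1 by omega]

/-- Division by the monic `(X + c) ^ r` leaves remainders of degree below `r`; their constant
coefficient matters modulo `P`, the others modulo `Q`. Spanning uses the elements known to lie in
`J`, independence the upper bound `hJ` together with `hc`. -/
theorem isBasisMod_blowupFamily {A ι κ : Type*} [CommRing A] [Algebra ℚ A] [Fintype ι] [Fintype κ]
    {P Q : Ideal A} {c : A} {r : ℕ} (hr : 0 < r) (hc : ∀ q ∈ Q, c ^ r * q ∈ P)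
    {J : Ideal (Polynomial A)} (hJ : J ≤ coeffIdeal P Q ⊔ Ideal.span {(X + C c) ^ r})
    (hP : ∀ p ∈ P, C p ∈ J) (hQ : ∀ q ∈ Q, X * C q ∈ J) (hX : (X + C c) ^ r ∈ J)
    {b : ι → A} {e : κ → A} (hb : IsBasisMod P b) (he : IsBasisMod Q e) :
    IsBasisMod J (blowupFamily b e r) where
  indep a ha := by
    have h := mem_coeffIdeal_of_degree_lt hc (hJ ha) (degree_blowupFamily_lt b e hr a)
    have h0 := h.1
    rw [coeff_zero_blowupFamily] at h0
    funext i
    rcases i with i | ⟨j, k⟩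
    · exact congrFun (hb.indep _ h0) i
    · have hj := h.2 (j + 1)
      rw [coeff_succ_blowupFamily] at hj
      exact congrFun (he.indep _ hj) k
  span f := by
    have hmon : ((X + C c) ^ r : Polynomial A).Monic := (monic_X_add_C c).pow r
    choose cb hcb using hb.span
    choose ce hce using he.span
    set g := f %ₘ ((X + C c) ^ r) with hg
    let a : ι ⊕ (Fin (r - 1) × κ) → ℚ :=
      Sum.elim (cb (g.coeff 0)) fun p => ce (g.coeff (p.1.1 + 1)) p.2
    refine ⟨a, ?_⟩
    have hfg : f - ∑ i, a i • blowupFamily b e r i =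
        (X + C c) ^ r * (f /ₘ ((X + C c) ^ r)) + (g - ∑ i, a i • blowupFamily b e r i) := by
      nth_rewrite 1 [← modByMonic_add_div f ((X + C c) ^ r)]
      ring
    rw [hfg]
    refine J.add_mem (J.mul_mem_right _ hX) ?_
    have hdeg : g.degree < r := by
      rcases subsingleton_or_nontrivial A with h | h
      · rw [Subsingleton.elim g 0, degree_zero]
        exact WithBot.bot_lt_coe r
      · have := degree_modByMonic_lt f hmon
        rwa [degree_X_add_C_pow] at this
    rw [as_sum_range_C_mul_X_pow (g - ∑ i, a i • blowupFamily b e r i)]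
    refine J.sum_mem fun n _ => ?_
    rcases n with _ | n
    · rw [pow_zero, mul_one, coeff_sub, coeff_zero_blowupFamily]
      exact hP _ (hcb _)
    · by_cases hn : n < r - 1
      · have := coeff_succ_blowupFamily b e r a ⟨n, hn⟩
        simp only at this
        rw [coeff_sub, this, pow_succ', ← mul_assoc, mul_comm (C _) X]
        exact J.mul_mem_right _ (hQ _ (hce _))
      · have h1 := (degree_lt_iff_coeff_zero _ _).1 hdeg (n + 1) (by omega)
        have h2 := (degree_lt_iff_coeff_zero _ _).1 (degree_blowupFamily_lt b e hr a) (n + 1)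
          (by omega)
        rw [coeff_sub, h1, h2]
        simp

end Polynomial

theorem IsBasisMod.of_equiv {A B ι : Type*} [CommRing A] [Algebra ℚ A] [CommRing B] [Algebra ℚ B]
    [Fintype ι] (φ : A ≃ₐ[ℚ] B) {I : Ideal A} {J : Ideal B} (hIJ : ∀ p, p ∈ I ↔ φ p ∈ J)
    {b : ι → B} (hb : IsBasisMod J b) : IsBasisMod I fun i => φ.symm (b i) where
  indep c hc := hb.indep c (by simpa [hIJ] using hc)
  span p := by
    obtain ⟨c, hc⟩ := hb.span (φ p)
    exact ⟨c, by simpa [hIJ] using hc⟩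

/-! ### Hilbert series read off from homogeneous bases. -/

/-- The quotient by `I` has a finite homogeneous basis whose degree generating series is `h`. -/
def HasHilbertSeries {σ : Type*} (I : Ideal (MvPolynomial σ ℚ)) (h : PowerSeries ℚ) : Prop :=
  ∃ (ι : Type) (_ : Fintype ι) (b : ι → MvPolynomial σ ℚ) (d : ι → ℕ),
    (∀ i, (b i).IsHomogeneous (d i)) ∧ IsBasisMod I b ∧ h = ∑ i, PowerSeries.X ^ d i

theorem HasHilbertSeries.rename {σ τ : Type*} (e : σ ≃ τ) {I : Ideal (MvPolynomial σ ℚ)}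
    {J : Ideal (MvPolynomial τ ℚ)} (hIJ : ∀ p, p ∈ J ↔ MvPolynomial.rename e.symm p ∈ I)
    {h : PowerSeries ℚ} (hI : HasHilbertSeries I h) : HasHilbertSeries J h := by
  obtain ⟨ι, _, b, d, hb, hbI, hh⟩ := hI
  refine ⟨ι, inferInstance, _, d, fun i => ?_,
    hbI.of_equiv (MvPolynomial.renameEquiv ℚ e.symm) hIJ, hh⟩
  exact (hb i).rename_isHomogeneous

open MvPolynomial in
/-- The dimensions of the graded pieces are the coefficients of the Hilbert series. -/
theorem HasHilbertSeries.finrank_eq {σ : Type*} {I : Ideal (MvPolynomial σ ℚ)} {h : PowerSeries ℚ}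
    (hI : HasHilbertSeries I h) (n : ℕ) (hcomp : ∀ p ∈ I, homogeneousComponent n p ∈ I) :
    (Module.finrank ℚ ((homogeneousSubmodule σ ℚ n).map
      (Ideal.Quotient.mkₐ ℚ I).toLinearMap) : ℚ) = PowerSeries.coeff n h := by
  classical
  obtain ⟨ι, _, b, d, hb, hbI, rfl⟩ := hI
  have hcoeff : PowerSeries.coeff n (∑ i, (PowerSeries.X : PowerSeries ℚ) ^ d i) =
      Fintype.card {i // d i = n} := by
    simp [PowerSeries.coeff_X_pow, Fintype.card_subtype, eq_comm]
  rw [hcoeff]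
  congr 1
  let v : {i // d i = n} → (homogeneousSubmodule σ ℚ n).map (Ideal.Quotient.mkₐ ℚ I).toLinearMap :=
    fun i => ⟨Ideal.Quotient.mkₐ ℚ I (b i), b i, by simpa [i.2] using hb i, rfl⟩
  have hind : LinearIndependent ℚ v := by
    rw [Fintype.linearIndependent_iff]
    intro a ha i
    have h0 : (Ideal.Quotient.mkₐ ℚ I) (∑ j : {i // d i = n}, a j • b j) = 0 := by
      have := congrArg Subtype.val ha
      simpa [v] using this
    have h1 : ∑ j : {i // d i = n}, a j • b j ∈ I := by
      rwa [Ideal.Quotient.mkₐ_eq_mk, Ideal.Quotient.eq_zero_iff_mem] at h0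
    -- A relation in degree `n` is extended by zero to the whole basis.
    have h2 := hbI.indep (fun i => if hi : d i = n then a ⟨i, hi⟩ else 0) (by
      convert h1 using 1
      rw [← Fintype.sum_subtype_add_sum_subtype (fun i => d i = n)]
      simp only [Subtype.coe_eta, dite_smul, zero_smul]
      rw [add_eq_left.2 (Finset.sum_eq_zero fun j _ => dif_neg j.2)]
      exact Finset.sum_congr rfl fun j _ => dif_pos j.2)
    simpa [i.2] using congrFun h2 i
  have hspan : ⊤ ≤ Submodule.span ℚ (Set.range v) := by
    rintro ⟨_, p, hp, rfl⟩ -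
    obtain ⟨c, hc⟩ := hbI.span p
    -- Passing to degree `n` discards the basis elements of every other degree.
    have hc' := hcomp _ hc
    have hp' : homogeneousComponent n p = p := by
      rw [homogeneousComponent_of_mem hp, if_pos rfl]
    have hbn : ∀ i, homogeneousComponent n (b i) = if d i = n then b i else 0 := fun i => by
      rw [homogeneousComponent_of_mem (hb i)]
      simp only [eq_comm]
    simp only [map_sub, map_sum, map_smul, hp', hbn] at hc'
    have : (⟨(Ideal.Quotient.mkₐ ℚ I).toLinearMap p, p, hp, rfl⟩ :
        (homogeneousSubmodule σ ℚ n).map (Ideal.Quotient.mkₐ ℚ I).toLinearMap) =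
        ∑ i : {i // d i = n}, c i • v i := by
      apply Subtype.ext
      rw [← Fintype.sum_subtype_add_sum_subtype (fun i => d i = n),
        Finset.sum_congr rfl fun j _ => congrArg (c j.1 • ·) (if_pos j.2),
        add_eq_left.2 (Finset.sum_eq_zero fun j _ => by rw [if_neg j.2, smul_zero])] at hc'
      have h : Ideal.Quotient.mkₐ ℚ I p =
          Ideal.Quotient.mkₐ ℚ I (∑ i : {i // d i = n}, c i • b i) := Ideal.Quotient.eq.2 hc'
      simp only [map_sum, map_smul] at h
      simpa [v] using h
    rw [this]
    exact Submodule.sum_mem _ fun i _ => Submodule.smul_mem _ _ (Submodule.subset_span ⟨i, rfl⟩)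
  rw [← Module.finrank_eq_card_basis (Module.Basis.mk hind hspan)]

/-! ### Relations indexed by a family in a ranked lattice -/

/-- The strictly increasing submodular functions on a lattice, with value `0` at the bottom. -/
structure IsRankFunction {L : Type*} [CompleteLattice L] (r : L → ℕ) : Prop where
  strictMono : StrictMono r
  submod : ∀ a b, r (a ⊔ b) + r (a ⊓ b) ≤ r a + r b
  bot : r ⊥ = 0

section Relations

variable {L : Type*} [CompleteLattice L] {r : L → ℕ}

/-- The join of the elements of `T` strictly below `G`. -/
def supLT (T : Set L) (G : L) : L := sSup {K ∈ T | K < G}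

theorem supLT_le (T : Set L) (G : L) : supLT T G ≤ G := sSup_le fun _ h => h.2.le

theorem le_supLT {T : Set L} {G K : L} (hK : K ∈ T) (h : K < G) : K ≤ supLT T G := le_sSup ⟨hK, h⟩

theorem supLT_le_iff {T : Set L} {G x : L} : supLT T G ≤ x ↔ ∀ K ∈ T, K < G → K ≤ x := by
  simp [supLT]

theorem supLT_congr {T T' : Set L} {G : L} (h : ∀ K, K < G → (K ∈ T ↔ K ∈ T')) :
    supLT T G = supLT T' G := by
  unfold supLT
  congr 1
  ext K
  constructor <;> rintro ⟨h1, h2⟩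
  · exact ⟨(h K h2).1 h1, h2⟩
  · exact ⟨(h K h2).2 h1, h2⟩

/-- The rank of `G` over the join of the elements of `T` strictly below it. -/
def relRank (r : L → ℕ) (T : Set L) (G : L) : ℕ := r G - r (supLT T G)

theorem relRank_congr {T T' : Set L} {G : L} (h : ∀ K, K < G → (K ∈ T ↔ K ∈ T')) :
    relRank r T G = relRank r T' G := by
  rw [relRank, relRank, supLT_congr h]

variable {σ A B : Type*} [Fintype σ] [CommRing A] [CommRing B]

open Classical in
/-- The sum of the variables whose index is at least `G`. -/
noncomputable def upperSum (g : σ → L) (x : σ → A) (G : L) : A := ∑ j with G ≤ g j, x j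

/-- The relations of the Chow ring, for an indexed family `g`, relative to a set `T`. -/
noncomputable def familyRelation (r : L → ℕ) (g : σ → L) (T : Set L) (x : σ → A) (S : Finset σ)
    (i : σ) : A :=
  (∏ j ∈ S, x j) * upperSum g x (g i) ^ relRank r (g '' S ∪ T) (g i)

/-- In the induction `T` holds members whose variable has been split off but which still count in
the joins. The Chow ideal is the case `T = ∅`. -/
noncomputable def familyIdeal (r : L → ℕ) (g : σ → L) (T : Set L) (x : σ → A) : Ideal A :=
  Ideal.span (Set.range fun p : Finset σ × σ => familyRelation r g T x p.1 p.2)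

theorem map_upperSum (φ : A →+* B) (g : σ → L) (x : σ → A) (G : L) :
    φ (upperSum g x G) = upperSum g (φ ∘ x) G := by
  simp [upperSum]

theorem map_familyRelation (φ : A →+* B) (g : σ → L) (T : Set L) (x : σ → A) (S : Finset σ)
    (i : σ) : φ (familyRelation r g T x S i) = familyRelation r g T (φ ∘ x) S i := by
  simp [familyRelation, map_upperSum]

theorem map_familyIdeal (φ : A →+* B) (g : σ → L) (T : Set L) (x : σ → A) :
    (familyIdeal r g T x).map φ = familyIdeal r g T (φ ∘ x) := by
  rw [familyIdeal, Ideal.map_span, familyIdeal, ← Set.range_comp]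
  congr 2
  funext p
  exact map_familyRelation φ g T x p.1 p.2

theorem familyRelation_mem (g : σ → L) (T : Set L) (x : σ → A) (S : Finset σ) (i : σ) :
    familyRelation r g T x S i ∈ familyIdeal r g T x :=
  Ideal.subset_span ⟨(S, i), rfl⟩

theorem prod_mul_upperSum_pow_mem (g : σ → L) (T : Set L) (x : σ → A) (S : Finset σ) (i : σ)
    {m : ℕ} (hm : relRank r (g '' S ∪ T) (g i) ≤ m) :
    (∏ j ∈ S, x j) * upperSum g x (g i) ^ m ∈ familyIdeal r g T x := by
  obtain ⟨k, rfl⟩ := Nat.exists_eq_add_of_le hm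
  rw [pow_add, ← mul_assoc]
  exact Ideal.mul_mem_right _ _ (familyRelation_mem g T x S i)

open Classical in
theorem mul_prod_mul_upperSum_pow_mem (g : σ → L) (T : Set L) (x : σ → A) (S : Finset σ) (i j : σ)
    {m : ℕ} (hm : relRank r (g '' (insert j S : Finset σ) ∪ T) (g i) ≤ m) :
    x j * ((∏ j ∈ S, x j) * upperSum g x (g i) ^ m) ∈ familyIdeal r g T x := by
  have h := prod_mul_upperSum_pow_mem g T x (insert j S) i hm
  by_cases hj : j ∈ S
  · rw [Finset.insert_eq_of_mem hj] at h
    exact Ideal.mul_mem_left _ _ h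
  · rwa [Finset.prod_insert hj, mul_assoc] at h

/-- Joins of non-disjoint members of the family belong to the family. -/
def ConnectedSupClosed (g : σ → L) : Prop := ∀ i j, g i ⊓ g j ≠ ⊥ → ∃ k, g k = g i ⊔ g j

/-- Both members lie strictly below their join, which is a member; the relation for the pair at this
join has exponent zero. -/
theorem mul_mem_familyIdeal_of_incomparable {g : σ → L} (hg : ConnectedSupClosed g) (T : Set L) (x : σ → A)
    {i j : σ} (hij : g i ⊓ g j ≠ ⊥) (h1 : ¬ g i ≤ g j) (h2 : ¬ g j ≤ g i) :
    x i * x j ∈ familyIdeal r g T x := by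
  classical
  obtain ⟨k, hk⟩ := hg i j hij
  have hi : g i < g k := hk ▸ left_lt_sup.2 h2
  have hj : g j < g k := hk ▸ right_lt_sup.2 h1
  have hne : i ≠ j := fun h => h1 (h ▸ le_rfl)
  have h0 : relRank r (g '' ({i, j} : Finset σ) ∪ T) (g k) = 0 := by
    have : supLT (g '' ({i, j} : Finset σ) ∪ T) (g k) = g k := by
      refine le_antisymm (supLT_le _ _) ?_
      nth_rewrite 1 [hk]
      exact sup_le (le_supLT (Or.inl ⟨i, by simp, rfl⟩) hi) (le_supLT (Or.inl ⟨j, by simp, rfl⟩) hj)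
    rw [relRank, this, Nat.sub_self]
  have := familyRelation_mem (r := r) g T x {i, j} k
  rwa [familyRelation, h0, pow_zero, mul_one, Finset.prod_pair hne] at this

/-- The difference consists of the `x l` with `g i ≤ g l` and `¬ g j ≤ g l`. Each such `g l` is
incomparable with `g j` and meets it above `K`, so `x j * x l` lies in the ideal. -/
theorem mul_upperSum_sub_mem {g : σ → L} (hg : ConnectedSupClosed g) (T : Set L) (x : σ → A) {K : L}
    (hK : K ≠ ⊥) {i j k : σ} (hi : K ≤ g i) (hj : K ≤ g j) (hij : ¬ g i ≤ g j)
    (hk : g k = g j ⊔ g i) :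
    x j * (upperSum g x (g i) - upperSum g x (g k)) ∈ familyIdeal r g T x := by
  classical
  have hsub : Finset.univ.filter (fun l => g k ≤ g l) ⊆ Finset.univ.filter fun l => g i ≤ g l := by
    intro l hl
    simp only [Finset.mem_filter, Finset.mem_univ, true_and] at hl ⊢
    exact (hk ▸ le_sup_right).trans hl
  have : upperSum g x (g i) - upperSum g x (g k) =
      ∑ l ∈ Finset.univ.filter (fun l => g i ≤ g l) \ Finset.univ.filter (fun l => g k ≤ g l),
        x l := by
    rw [sub_eq_iff_eq_add, upperSum, upperSum]
    convert (Finset.sum_sdiff hsub).symm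
  rw [this, Finset.mul_sum]
  refine Ideal.sum_mem _ fun l hl => ?_
  simp only [Finset.mem_sdiff, Finset.mem_filter, Finset.mem_univ, true_and, hk, sup_le_iff,
    not_and] at hl
  have hjl : ¬ g j ≤ g l := fun h => hl.2 h hl.1
  have hne : g j ⊓ g l ≠ ⊥ := fun h => hK (le_bot_iff.1 (h ▸ le_inf hj (hi.trans hl.1)))
  exact mul_mem_familyIdeal_of_incomparable hg T x hne hjl fun h => hij (hl.1.trans h)

/-- The condition that makes the passage from `T` to `insert K T` a blow-up. -/
theorem upperSum_pow_mul_mem (hr : IsRankFunction r) {g : σ → L} (hg : ConnectedSupClosed g) (T : Set L)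
    (x : σ → A) {K : L} (hK : K ≠ ⊥) {q : A}
    (hq : q ∈ familyIdeal r g (insert K T) x) :
    upperSum g x K ^ relRank r T K * q ∈ familyIdeal r g T x := by
  classical
  refine Submodule.span_induction ?_ ?_ ?_ ?_ hq
  · rintro _ ⟨⟨S, i⟩, rfl⟩
    dsimp only
    -- Inserting `K` into `T` changes only the relations at members strictly above `K`.
    by_cases hKi : K < g i
    swap
    · refine Ideal.mul_mem_left _ _ ?_
      have : relRank r (g '' S ∪ insert K T) (g i) = relRank r (g '' S ∪ T) (g i) :=
        relRank_congr fun K' hK' => by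
          have : K' ≠ K := fun h => hKi (h ▸ hK')
          simp [this]
      rw [familyRelation, this]
      exact familyRelation_mem g T x S i
    set G := g i with hG
    set s := supLT (g '' S ∪ T) G with hs
    set s' := supLT (g '' S ∪ insert K T) G with hs'
    have hsG : s ≤ G := supLT_le _ _
    have hs's : s' ≤ s ⊔ K := by
      refine supLT_le_iff.2 fun K' hK' hlt => ?_
      rcases hK' with h | h | h
      · exact le_sup_of_le_left (le_supLT (Or.inl h) hlt)
      · exact h ▸ le_sup_right
      · exact le_sup_of_le_left (le_supLT (Or.inr h) hlt)
    have hd : relRank r (g '' S ∪ insert K T) G = r G - r s' := rfl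
    have hmono := hr.strictMono.monotone
    -- the part of `upperSum g x K` outside `upperSum g x G`
    have hsub : Finset.univ.filter (fun l => G ≤ g l) ⊆ Finset.univ.filter fun l => K ≤ g l := by
      intro l hl
      simp only [Finset.mem_filter, Finset.mem_univ, true_and] at hl ⊢
      exact hKi.le.trans hl
    have hsplit : upperSum g x K - upperSum g x G =
        ∑ l ∈ Finset.univ.filter (fun l => K ≤ g l) \ Finset.univ.filter (fun l => G ≤ g l),
          x l := by
      rw [sub_eq_iff_eq_add, upperSum, upperSum]
      convert (Finset.sum_sdiff hsub).symm
    have hrest : (upperSum g x K - upperSum g x G) * familyRelation r g (insert K T) x S i ∈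
        familyIdeal r g T x := by
      rw [hsplit, Finset.sum_mul]
      refine Ideal.sum_mem _ fun j hj => ?_
      simp only [Finset.mem_sdiff, Finset.mem_filter, Finset.mem_univ, true_and] at hj
      obtain ⟨hKj, hGj⟩ := hj
      rw [familyRelation, ← hG, hd]
      -- If `g j < G`, then `g j ≥ K` takes over the role of `K` in the join. Otherwise `G` is
      -- replaced by the join `g k` of `g j` and `G`.
      by_cases hjG : g j < G
      · refine mul_prod_mul_upperSum_pow_mem g T x S i j ?_
        refine Nat.sub_le_sub_left (hmono (supLT_le_iff.2 fun K' hK' hlt => ?_)) _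
        rcases hK' with ⟨l, hl, rfl⟩ | h | h
        · exact le_supLT (Or.inl ⟨l, by simp [Finset.mem_coe.1 hl], rfl⟩) hlt
        · rw [h]
          exact hKj.trans (le_supLT (Or.inl ⟨j, by simp, rfl⟩) hjG)
        · exact le_supLT (Or.inr h) hlt
      · have hne : g j ⊓ g i ≠ ⊥ := fun h => hK (le_bot_iff.1 (h ▸ le_inf hKj hKi.le))
        obtain ⟨k, hk⟩ := hg j i hne
        have hdiff := mul_upperSum_sub_mem (r := r) hg T x hK hKi.le hKj hGj hk
        obtain ⟨t, ht⟩ := sub_dvd_pow_sub_pow (upperSum g x G) (upperSum g x (g k)) (r G - r s')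
        have hmain : x j * ((∏ j ∈ S, x j) * upperSum g x (g k) ^ (r G - r s')) ∈
            familyIdeal r g T x := by
          refine mul_prod_mul_upperSum_pow_mem g T x S k j ?_
          have hjk : g j < g k := by
            rw [hk, left_lt_sup]
            exact hGj
          have hGk : G ≤ g k := hk ▸ le_sup_right
          have h1 : g j ⊔ s ≤ supLT (g '' (insert j S : Finset σ) ∪ T) (g k) := by
            refine sup_le (le_supLT (Or.inl ⟨j, by simp, rfl⟩) hjk)
              (supLT_le_iff.2 fun K' hK' hlt => le_supLT ?_ (hlt.trans_le hGk))
            rcases hK' with ⟨l, hl, rfl⟩ | h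
            · exact Or.inl ⟨l, by simp [Finset.mem_coe.1 hl], rfl⟩
            · exact Or.inr h
          have h2 := hr.submod G (g j ⊔ s)
          have h3 : G ⊔ (g j ⊔ s) = g k := by
            rw [hk]
            exact le_antisymm (sup_le le_sup_right (sup_le le_sup_left (hsG.trans le_sup_right)))
              (sup_le (le_sup_of_le_right le_sup_left) le_sup_left)
          -- Submodularity for `G` and `g j ⊔ s` now shows that the exponent required at `g k` is at
          -- most `r G - r s'`.
          have h4 : s' ≤ G ⊓ (g j ⊔ s) := le_inf (supLT_le _ _)
            (hs's.trans (sup_le le_sup_right (hKj.trans le_sup_left)))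
          rw [h3] at h2
          have h5 := hmono h1
          have h6 := hmono h4
          rw [relRank]
          omega
        have : x j * ((∏ j ∈ S, x j) * upperSum g x G ^ (r G - r s')) =
            x j * ((∏ j ∈ S, x j) * upperSum g x (g k) ^ (r G - r s')) +
              x j * (upperSum g x G - upperSum g x (g k)) * ((∏ j ∈ S, x j) * t) := by
          rw [eq_add_of_sub_eq ht]
          ring
        rw [this]
        exact Ideal.add_mem _ hmain (Ideal.mul_mem_right _ _ hdiff)
    -- The exponents add up to enough for `T`: by submodularity `r s' - r s` is at most `r K - r (s
    -- ⊓ K)`, hence at most `relRank r T K`.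
    have htop : upperSum g x G ^ relRank r T K * familyRelation r g (insert K T) x S i ∈
        familyIdeal r g T x := by
      rw [familyRelation, ← hG, hd, mul_left_comm, ← pow_add]
      refine prod_mul_upperSum_pow_mem g T x S i ?_
      have h1 : supLT T K ≤ s ⊓ K := le_inf
        (supLT_le_iff.2 fun K' hK' hlt => le_supLT (Or.inr hK') (hlt.trans hKi)) (supLT_le _ _)
      have h2 := hr.submod s K
      have h3 := hmono h1
      have h4 := hmono hs's
      have h5 := hmono (supLT_le T K)
      rw [relRank, relRank, ← hG, ← hs]
      omega
    -- The power at `K` differs from the power at `G` by a multiple of the difference of the two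
    -- sums, which `hrest` handles.
    obtain ⟨t, ht⟩ := sub_dvd_pow_sub_pow (upperSum g x K) (upperSum g x G) (relRank r T K)
    have : upperSum g x K ^ relRank r T K * familyRelation r g (insert K T) x S i =
        upperSum g x G ^ relRank r T K * familyRelation r g (insert K T) x S i +
          (upperSum g x K - upperSum g x G) * familyRelation r g (insert K T) x S i * t := by
      rw [eq_add_of_sub_eq ht]
      ring
    rw [this]
    exact Ideal.add_mem _ htop (Ideal.mul_mem_right _ _ hrest)
  · simp
  · intro a b _ _ ha hb
    rw [mul_add]
    exact Ideal.add_mem _ ha hb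
  · intro a b _ hb
    rw [smul_eq_mul, mul_left_comm]
    exact Ideal.mul_mem_left _ _ hb

end Relations

/-! ### The Hilbert series by successive blow-ups -/

/-- `x + x ^ 2 + ⋯ + x ^ (d - 1)`. -/
noncomputable def truncGeom (d : ℕ) : PowerSeries ℚ := ∑ j : Fin (d - 1), PowerSeries.X ^ (j.1 + 1)

theorem Finset.sum_finset_fin_succ {n : ℕ} {β : Type*} [AddCommMonoid β]
    (f : Finset (Fin (n + 1)) → β) :
    ∑ S, f S = ∑ S : Finset (Fin n), f (S.map (Fin.succEmb n)) +
      ∑ S : Finset (Fin n), f (insert 0 (S.map (Fin.succEmb n))) := by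
  classical
  have huniv : (Finset.univ : Finset (Fin (n + 1))) =
      insert 0 ((Finset.univ : Finset (Fin n)).image (Fin.succEmb n)) := by
    ext i
    refine Fin.cases ?_ (fun j => ?_) i <;> simp
  have h0 : (0 : Fin (n + 1)) ∉ (Finset.univ : Finset (Fin n)).image (Fin.succEmb n) := by simp
  rw [← Finset.powerset_univ, huniv, Finset.sum_powerset_insert h0, Finset.powerset_image,
    Finset.powerset_univ,
    Finset.sum_image (Finset.image_injective (Fin.succEmb n).injective).injOn,
    Finset.sum_image (Finset.image_injective (Fin.succEmb n).injective).injOn]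
  simp only [Finset.map_eq_image]

theorem image_map_succEmb {L : Type*} {n : ℕ} (g : Fin (n + 1) → L) (S : Finset (Fin n)) :
    g '' (S.map (Fin.succEmb n) : Finset (Fin (n + 1))) = (fun i : Fin n => g i.succ) '' S := by
  ext x
  simp

theorem image_insert_zero_union {L : Type*} {n : ℕ} (g : Fin (n + 1) → L) (T : Set L) (S : Finset (Fin n)) :
    g '' (insert 0 (S.map (Fin.succEmb n)) : Finset (Fin (n + 1))) ∪ T =
      (fun i : Fin n => g i.succ) '' S ∪ insert (g 0) T := by
  rw [Finset.coe_insert, Set.image_insert_eq, image_map_succEmb, Set.insert_union,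
    Set.union_insert]

section

variable {L : Type*} [CompleteLattice L] {r : L → ℕ}

/-- An enumeration of a building set by increasing rank. -/
structure IsRankedFamily (r : L → ℕ) {n : ℕ} (g : Fin n → L) : Prop where
  injective : Function.Injective g
  ne_bot : ∀ i, g i ≠ ⊥
  mono : Monotone (r ∘ g)
  closed : ConnectedSupClosed g

theorem IsRankedFamily.index_le (hr : IsRankFunction r) {n : ℕ} {g : Fin n → L}
    (hg : IsRankedFamily r g) {i j : Fin n} (h : g i ≤ g j) : i ≤ j := by
  rcases h.eq_or_lt with h | h
  · exact (hg.injective h).le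
  · by_contra hij
    exact absurd (hr.strictMono h) (not_lt.2 (hg.mono (not_le.1 hij).le))

/-- A join of later members lies above one of them, so it cannot be the first member. -/
theorem IsRankedFamily.tail (hr : IsRankFunction r) {n : ℕ} {g : Fin (n + 1) → L}
    (hg : IsRankedFamily r g) : IsRankedFamily r fun i : Fin n => g i.succ where
  injective := hg.injective.comp (Fin.succ_injective n)
  ne_bot i := hg.ne_bot _
  mono i j h := hg.mono (Fin.succ_le_succ_iff.2 h)
  closed i j h := by
    obtain ⟨k, hk⟩ := hg.closed _ _ h
    have hik : i.succ ≤ k := hg.index_le hr (hk ▸ le_sup_left)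
    obtain ⟨l, rfl⟩ := Fin.exists_succ_eq.2 ((Fin.succ_pos i).trans_le hik).ne'
    exact ⟨l, hk⟩

open Classical in
/-- The Hilbert series of the relations `familyIdeal r g T`. -/
noncomputable def familySeries (r : L → ℕ) {n : ℕ} (g : Fin n → L) (T : Set L) : PowerSeries ℚ :=
  -- A relation with exponent zero kills the monomial with support `S`, so such supports contribute
  -- nothing.
  ∑ S : Finset (Fin n), if ∀ i, 1 ≤ relRank r (g '' S ∪ T) (g i) then
    ∏ i ∈ S, truncGeom (relRank r (g '' S ∪ T) (g i)) else 0

/-- No member of the family lies strictly below the first one, so only `T` matters there. -/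
theorem IsRankedFamily.relRank_zero (hr : IsRankFunction r) {n : ℕ} {g : Fin (n + 1) → L}
    (hg : IsRankedFamily r g) (S : Finset (Fin (n + 1))) (T : Set L) :
    relRank r (g '' S ∪ T) (g 0) = relRank r T (g 0) := by
  refine relRank_congr fun K hK => ⟨?_, Or.inr⟩
  rintro (⟨i, -, rfl⟩ | h)
  · exact absurd (hg.index_le hr hK.le) (by
      intro hi
      rw [Fin.le_zero_iff] at hi
      exact hK.ne (by rw [hi]))
  · exact h

theorem familySeries_zero (hr : IsRankFunction r) {n : ℕ} {g : Fin (n + 1) → L}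
    (hg : IsRankedFamily r g) {T : Set L} (h : relRank r T (g 0) = 0) :
    familySeries r g T = 0 := by
  refine Finset.sum_eq_zero fun S _ => if_neg fun hS => ?_
  have := hS 0
  rw [hg.relRank_zero hr, h] at this
  omega

/-- Supports are split by whether they contain `0`; if they do, `g 0` contributes its own factor and
from then on acts as an element of `T`. -/
theorem familySeries_succ (hr : IsRankFunction r) {n : ℕ} {g : Fin (n + 1) → L}
    (hg : IsRankedFamily r g) {T : Set L} (h : 0 < relRank r T (g 0)) :
    familySeries r g T = familySeries r (fun i : Fin n => g i.succ) T +
      truncGeom (relRank r T (g 0)) *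
        familySeries r (fun i : Fin n => g i.succ) (insert (g 0) T) := by
  classical
  have h0 : 1 ≤ relRank r T (g 0) := h
  rw [familySeries, Finset.sum_finset_fin_succ]
  simp only [Fin.forall_fin_succ, hg.relRank_zero hr, h0, true_and]
  simp only [image_map_succEmb, image_insert_zero_union]
  congr 1
  · simp only [familySeries, Finset.prod_map, Fin.coe_succEmb]
  · rw [familySeries, Finset.mul_sum]
    refine Finset.sum_congr rfl fun S _ => ?_
    rw [mul_ite, mul_zero, Finset.prod_insert (by simp), Finset.prod_map]
    congr 2
    rw [← image_insert_zero_union, hg.relRank_zero hr]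

/-- Enlarging `T` enlarges the joins and hence lowers the exponents. -/
theorem familyIdeal_mono (hr : IsRankFunction r) {σ A : Type*} [Fintype σ] [CommRing A]
    (g : σ → L) {T T' : Set L} (h : T ⊆ T') (x : σ → A) :
    familyIdeal r g T x ≤ familyIdeal r g T' x := by
  refine Ideal.span_le.2 ?_
  rintro _ ⟨⟨S, i⟩, rfl⟩
  refine prod_mul_upperSum_pow_mem g T' x S i (Nat.sub_le_sub_left (hr.strictMono.monotone ?_) _)
  exact supLT_le_iff.2 fun K hK hlt => le_supLT (Set.union_subset_union_right _ h hK) hlt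

theorem Finset.eq_map_succ_or_insert {n : ℕ} (S : Finset (Fin (n + 1))) :
    ∃ S' : Finset (Fin n), S = S'.map (Fin.succEmb n) ∨ S = insert 0 (S'.map (Fin.succEmb n)) := by
  classical
  refine ⟨Finset.univ.filter fun i => i.succ ∈ S, ?_⟩
  by_cases h : (0 : Fin (n + 1)) ∈ S
  · right
    ext i
    refine Fin.cases ?_ (fun j => ?_) i <;> simp [h]
  · left
    ext i
    refine Fin.cases ?_ (fun j => ?_) i <;> simp [h]

/-! ### Adjoining the variable of the first member. -/

section Step

variable {A : Type*} [CommRing A] {n : ℕ} {g : Fin (n + 1) → L} (T : Set L) (x : Fin n → A)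

/-- The variables after adjoining a polynomial variable with index `0`. -/
noncomputable def consX : Fin (n + 1) → Polynomial A :=
  Fin.cons Polynomial.X fun i => Polynomial.C (x i)

@[simp]
theorem consX_zero : consX x 0 = Polynomial.X := rfl

@[simp]
theorem consX_succ (i : Fin n) : consX x i.succ = Polynomial.C (x i) := rfl

theorem upperSum_consX_zero :
    upperSum g (consX x) (g 0) =
      Polynomial.X + Polynomial.C (upperSum (fun i : Fin n => g i.succ) x (g 0)) := by
  classical
  simp [upperSum, Finset.sum_filter, Fin.sum_univ_succ, apply_ite Polynomial.C]

theorem upperSum_consX_succ (hr : IsRankFunction r) (hg : IsRankedFamily r g) (i : Fin n) :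
    upperSum g (consX x) (g i.succ) =
      Polynomial.C (upperSum (fun i : Fin n => g i.succ) x (g i.succ)) := by
  classical
  have : ¬ g i.succ ≤ g 0 := fun h => by
    have := hg.index_le hr h
    simp at this
  simp [upperSum, Finset.sum_filter, Fin.sum_univ_succ, apply_ite Polynomial.C, this]

theorem familyRelation_map_succ (hr : IsRankFunction r) (hg : IsRankedFamily r g)
    (S : Finset (Fin n)) (i : Fin n) :
    familyRelation r g T (consX x) (S.map (Fin.succEmb n)) i.succ =
      Polynomial.C (familyRelation r (fun i : Fin n => g i.succ) T x S i) := by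
  rw [familyRelation, familyRelation, image_map_succEmb, upperSum_consX_succ x hr hg]
  simp

theorem familyRelation_insert_zero (hr : IsRankFunction r) (hg : IsRankedFamily r g)
    (S : Finset (Fin n)) (i : Fin n) :
    familyRelation r g T (consX x) (insert 0 (S.map (Fin.succEmb n))) i.succ =
      Polynomial.X * Polynomial.C
        (familyRelation r (fun i : Fin n => g i.succ) (insert (g 0) T) x S i) := by
  rw [familyRelation, familyRelation, Finset.prod_insert (by simp), image_insert_zero_union,
    upperSum_consX_succ x hr hg]
  simp [mul_assoc]

theorem familyRelation_zero (hr : IsRankFunction r) (hg : IsRankedFamily r g)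
    (S : Finset (Fin (n + 1))) :
    familyRelation r g T (consX x) S 0 = (∏ j ∈ S, consX x j) *
      (Polynomial.X + Polynomial.C (upperSum (fun i : Fin n => g i.succ) x (g 0))) ^
        relRank r T (g 0) := by
  rw [familyRelation, hg.relRank_zero hr, upperSum_consX_zero]

/-- Relations at index `0` are multiples of `(X + c) ^ m`. At later indices they are constants from
the ideal for `T` when `0 ∉ S`, and `X` times elements of the ideal for `insert (g 0) T` when `0 ∈
S`. The blow-up hypothesis is `upperSum_pow_mul_mem`. -/
theorem isBasisMod_consX (hr : IsRankFunction r) (hg : IsRankedFamily r g) [Algebra ℚ A]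
    (h0 : 0 < relRank r T (g 0)) {ι κ : Type*} [Fintype ι] [Fintype κ] {b : ι → A} {e : κ → A}
    (hb : IsBasisMod (familyIdeal r (fun i : Fin n => g i.succ) T x) b)
    (he : IsBasisMod (familyIdeal r (fun i : Fin n => g i.succ) (insert (g 0) T) x) e) :
    IsBasisMod (familyIdeal r g T (consX x))
      (Polynomial.blowupFamily b e (relRank r T (g 0))) := by
  refine Polynomial.isBasisMod_blowupFamily (c := upperSum (fun i : Fin n => g i.succ) x (g 0)) h0
    (fun q hq => upperSum_pow_mul_mem hr (hg.tail hr).closed T x (hg.ne_bot 0) hq)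
    ?_ ?_ ?_ ?_ hb he
  · refine Ideal.span_le.2 ?_
    rintro _ ⟨⟨S, i⟩, rfl⟩
    dsimp only
    induction i using Fin.cases with
    | zero =>
      rw [familyRelation_zero T x hr hg]
      exact Ideal.mul_mem_left _ _
        (Ideal.mem_sup_right (Ideal.subset_span (Set.mem_singleton _)))
    | succ i =>
      refine Ideal.mem_sup_left ?_
      obtain ⟨S, rfl | rfl⟩ := S.eq_map_succ_or_insert
      · rw [familyRelation_map_succ T x hr hg]
        have h := familyRelation_mem (r := r) (fun i : Fin n => g i.succ) T x S i
        refine ⟨by simpa using h, fun k => ?_⟩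
        rw [Polynomial.coeff_C]
        split_ifs
        · exact familyIdeal_mono hr _ (Set.subset_insert _ _) x h
        · exact Ideal.zero_mem _
      · rw [familyRelation_insert_zero T x hr hg]
        have h := familyRelation_mem (r := r) (fun i : Fin n => g i.succ) (insert (g 0) T) x S i
        refine ⟨by simp, fun k => ?_⟩
        rcases k with _ | k
        · simp
        · rw [Polynomial.coeff_X_mul, Polynomial.coeff_C]
          split_ifs
          · exact h
          · exact Ideal.zero_mem _
  · suffices familyIdeal r (fun i : Fin n => g i.succ) T x ≤
        (familyIdeal r g T (consX x)).comap Polynomial.C from fun p hp => this hp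
    refine Ideal.span_le.2 ?_
    rintro _ ⟨⟨S, i⟩, rfl⟩
    rw [SetLike.mem_coe, Ideal.mem_comap, ← familyRelation_map_succ T x hr hg]
    exact familyRelation_mem _ _ _ _ _
  · intro q hq
    refine Submodule.span_induction ?_ ?_ ?_ ?_ hq
    · rintro _ ⟨⟨S, i⟩, rfl⟩
      rw [← familyRelation_insert_zero T x hr hg]
      exact familyRelation_mem _ _ _ _ _
    · simp
    · intro a b _ _ ha hb
      rw [Polynomial.C_add, mul_add]
      exact Ideal.add_mem _ ha hb
    · intro a b _ hb
      rw [smul_eq_mul, Polynomial.C_mul, mul_left_comm]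
      exact Ideal.mul_mem_left _ _ hb
  · have := familyRelation_mem (r := r) g T (consX x) ∅ 0
    rwa [familyRelation_zero T x hr hg, Finset.prod_empty, one_mul] at this

end Step

open MvPolynomial in
-- Induction on the number of variables; `T` is left general because the step calls on both `T` and
-- `insert (g 0) T`.
theorem hasHilbertSeries_familyIdeal (hr : IsRankFunction r) {n : ℕ} {g : Fin n → L}
    (hg : IsRankedFamily r g) (T : Set L) :
    HasHilbertSeries (familyIdeal r g T (X : Fin n → MvPolynomial (Fin n) ℚ))
      (familySeries r g T) := by
  induction n generalizing T with
  | zero =>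
    have hI : familyIdeal r g T (X : Fin 0 → MvPolynomial (Fin 0) ℚ) = ⊥ := by
      rw [familyIdeal, Set.range_eq_empty, Ideal.span_empty]
    refine ⟨Unit, inferInstance, fun _ => 1, fun _ => 0, fun _ => isHomogeneous_one _ _,
      ⟨fun c hc => ?_, fun p => ⟨fun _ => p.coeff 0, ?_⟩⟩, ?_⟩
    · funext i
      simpa [hI] using hc
    · rw [hI, Ideal.mem_bot]
      nth_rewrite 1 [p.eq_C_of_isEmpty]
      simp [smul_eq_C_mul]
    · rw [familySeries, Fintype.sum_unique, if_pos (fun i => i.elim0),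
        Finset.eq_empty_of_isEmpty default]
      simp
  | succ n ih =>
    rcases Nat.eq_zero_or_pos (relRank r T (g 0)) with h0 | h0
    · rw [familySeries_zero hr hg h0]
      -- The relation for the empty set at the first member is `1`, so the quotient is zero and has
      -- the empty basis.
      have hI : familyIdeal r g T (X : Fin (n + 1) → MvPolynomial (Fin (n + 1)) ℚ) = ⊤ := by
        rw [Ideal.eq_top_iff_one]
        have := familyRelation_mem (r := r) g T (X : _ → MvPolynomial (Fin (n + 1)) ℚ) ∅ 0
        rwa [familyRelation, hg.relRank_zero hr, h0, Finset.prod_empty, pow_zero, mul_one] at this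
      exact ⟨Empty, inferInstance, fun i => i.elim, fun i => i.elim, fun i => i.elim,
        ⟨fun c _ => Subsingleton.elim _ _, fun p => ⟨fun i => i.elim, by simp [hI]⟩⟩, by simp⟩
    · obtain ⟨ι, _, b, d, hb, hbI, hh⟩ := ih (hg.tail hr) T
      obtain ⟨κ, _, e, d', he, heI, hh'⟩ := ih (hg.tail hr) (insert (g 0) T)
      have hbasis := isBasisMod_consX T _ hr hg h0 hbI heI
      have hx : RingHomClass.toRingHom (finSuccEquiv ℚ n) ∘ X = consX X := by
        funext i
        induction i using Fin.cases with
        | zero => exact finSuccEquiv_X_zero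
        | succ i => exact finSuccEquiv_X_succ
      have hx' : (RingHomClass.toRingHom (finSuccEquiv ℚ n).symm) ∘ consX X = X := by
        rw [← hx]
        funext i
        simp
      refine ⟨ι ⊕ (Fin (relRank r T (g 0) - 1) × κ), inferInstance, _,
        Sum.elim d fun p => p.1.1 + 1 + d' p.2, ?_,
        hbasis.of_equiv (finSuccEquiv ℚ n) fun p => ⟨fun hp => ?_, fun hp => ?_⟩, ?_⟩
      · have hC : ∀ p : MvPolynomial (Fin n) ℚ,
            (finSuccEquiv ℚ n).symm (Polynomial.C p) = rename Fin.succ p := fun p => by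
          rw [AlgEquiv.symm_apply_eq]
          induction p using MvPolynomial.induction_on with
          | C a => simp [finSuccEquiv_apply]
          | add p q hp hq => simp [hp, hq]
          | mul_X p i hp => simp [hp, finSuccEquiv_X_succ]
        have hX : (finSuccEquiv ℚ n).symm Polynomial.X = X 0 := by
          rw [AlgEquiv.symm_apply_eq, finSuccEquiv_X_zero]
        rintro (i | ⟨j, k⟩)
        · simp only [Polynomial.blowupFamily, Sum.elim_inl, hC]
          exact (hb i).rename_isHomogeneous
        · simp only [Polynomial.blowupFamily, Sum.elim_inr, map_mul, map_pow, hC, hX]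
          rw [mul_comm]
          refine IsHomogeneous.mul ?_ (he k).rename_isHomogeneous
          simpa using (isHomogeneous_X ℚ (0 : Fin (n + 1))).pow (j.1 + 1)
      · rw [← hx, ← map_familyIdeal]
        exact Ideal.mem_map_of_mem _ hp
      · have := Ideal.mem_map_of_mem (RingHomClass.toRingHom (finSuccEquiv ℚ n).symm) hp
        rw [map_familyIdeal, hx'] at this
        simpa using this
      · rw [familySeries_succ hr hg h0, hh, hh', Fintype.sum_sum_type, Fintype.sum_prod_type,
          truncGeom, Finset.sum_mul_sum]
        simp [pow_add]

end

/-! ### Sums over chains -/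

theorem strictMono_fin_succ_iff {L : Type*} [PartialOrder L] {m : ℕ} {c : Fin (m + 2) → L} :
    StrictMono c ↔ StrictMono (fun i : Fin (m + 1) => c i.castSucc) ∧
      c (Fin.last m).castSucc < c (Fin.last (m + 1)) := by
  rw [Fin.strictMono_iff_lt_succ, Fin.strictMono_iff_lt_succ, Fin.forall_fin_succ']
  simp

section Chains

variable {L R : Type*} [PartialOrder L] [OrderBot L] [Fintype L] [CommRing R]

open Classical in
/-- The chains `⊥ = c 0 < ⋯ < c m = E`. -/
noncomputable def chainsTo (m : ℕ) (E : L) : Finset (Fin (m + 1) → L) :=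
  Finset.univ.filter fun c => StrictMono c ∧ c 0 = ⊥ ∧ c (Fin.last m) = E

theorem mem_chainsTo {m : ℕ} {E : L} {c : Fin (m + 1) → L} :
    c ∈ chainsTo m E ↔ StrictMono c ∧ c 0 = ⊥ ∧ c (Fin.last m) = E := by
  simp [chainsTo]

/-- The signed sum over chains of length `m` from `⊥` to `E` of products of `κ`. -/
noncomputable def chainSum (κ : L → L → R) (m : ℕ) (E : L) : R :=
  ∑ c ∈ chainsTo m E, (-1) ^ m * ∏ i : Fin m, κ (c i.castSucc) (c i.succ)

theorem chainSum_zero_bot (κ : L → L → R) : chainSum κ 0 ⊥ = 1 := by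
  have : chainsTo 0 (⊥ : L) = {fun _ => ⊥} := by
    ext c
    rw [mem_chainsTo, Finset.mem_singleton]
    constructor
    · rintro ⟨-, h, -⟩
      funext i
      rw [Fin.fin_one_eq_zero i, h]
    · rintro rfl
      exact ⟨fun i j h => absurd h (by omega), rfl, rfl⟩
  simp [chainSum, this]

theorem chainSum_zero_of_ne_bot (κ : L → L → R) {E : L} (hE : E ≠ ⊥) : chainSum κ 0 E = 0 := by
  refine Finset.sum_eq_zero fun c hc => ?_
  obtain ⟨-, h0, h1⟩ := mem_chainsTo.1 hc
  exact absurd (h1.symm.trans h0) hE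

open Classical in
-- The last step of the chain is split off; `F` is the penultimate member.
theorem chainSum_succ (κ : L → L → R) (m : ℕ) (E : L) :
    chainSum κ (m + 1) E = -∑ F : L with F < E, chainSum κ m F * κ F E := by
  simp only [chainSum, Finset.sum_mul]
  rw [Finset.sum_sigma', ← Finset.sum_neg_distrib]
  refine Finset.sum_bij' (fun c _ => ⟨c (Fin.last m).castSucc, fun i => c i.castSucc⟩)
    (fun p _ => (Fin.snoc p.2 E : Fin (m + 2) → L)) ?_ ?_ ?_ ?_ ?_
  · intro c hc
    obtain ⟨h1, h2, h3⟩ := mem_chainsTo.1 hc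
    rw [strictMono_fin_succ_iff, h3] at h1
    simp only [Finset.mem_sigma, Finset.mem_filter, Finset.mem_univ, true_and, mem_chainsTo]
    exact ⟨h1.2, h1.1, h2, trivial⟩
  · rintro ⟨F, c⟩ hc
    simp only [Finset.mem_sigma, Finset.mem_filter, Finset.mem_univ, true_and,
      mem_chainsTo] at hc
    obtain ⟨h1, h2, h3, h4⟩ := hc
    rw [mem_chainsTo, strictMono_fin_succ_iff]
    refine ⟨⟨by simpa using h2, by simpa [h4] using h1⟩, ?_, by simp⟩
    exact (Fin.snoc_castSucc (α := fun _ => L) E c 0).trans h3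
  · intro c hc
    obtain ⟨h1, h2, h3⟩ := mem_chainsTo.1 hc
    rw [← h3]
    exact Fin.snoc_init_self c
  · rintro ⟨F, c⟩ hc
    simp only [Finset.mem_sigma, Finset.mem_filter, Finset.mem_univ, true_and,
      mem_chainsTo] at hc
    simp [hc.2.2.2]
  · intro c hc
    obtain ⟨h1, h2, h3⟩ := mem_chainsTo.1 hc
    rw [Fin.prod_univ_castSucc, Fin.succ_last, h3, pow_succ]
    simp only [Fin.succ_castSucc]
    ring

open Classical in
/-- A function satisfying the recursion of the left inverse of `κ` is a sum over chains. -/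
theorem eq_sum_chainSum (κ : L → L → R) (h : L → R) (ρ : L → ℕ) (hρ : StrictMono ρ)
    (hbot : h ⊥ = 1) (hrec : ∀ E, E ≠ ⊥ → h E = -∑ F : L with F < E, h F * κ F E) (N : ℕ) (E : L)
    (hN : ρ E ≤ N) : h E = ∑ m ∈ Finset.range (N + 1), chainSum κ m E := by
  induction N generalizing E with
  | zero =>
    have hE : E = ⊥ := by
      by_contra hne
      have := hρ (bot_lt_iff_ne_bot.2 hne)
      omega
    simp [hE, hbot, chainSum_zero_bot]
  | succ N ih =>
    rw [Finset.sum_range_succ']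
    simp only [chainSum_succ]
    by_cases hE : E = ⊥
    · subst hE
      simp [hbot, chainSum_zero_bot]
    · rw [chainSum_zero_of_ne_bot κ hE, add_zero, Finset.sum_neg_distrib, Finset.sum_comm, hrec E hE]
      congr 1
      refine Finset.sum_congr rfl fun F hF => ?_
      have hF' := hρ (Finset.mem_filter.1 hF).2
      rw [ih F (by omega), Finset.sum_mul]

end Chains

/-! ### The recursion for the Hilbert series -/

theorem one_sub_mul_truncGeom {d : ℕ} (hd : 1 ≤ d) :
    (1 - PowerSeries.X) * truncGeom d = PowerSeries.X - PowerSeries.X ^ d := by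
  obtain ⟨e, rfl⟩ := Nat.exists_eq_add_of_le' hd
  have h := mul_neg_geom_sum (PowerSeries.X : PowerSeries ℚ) e
  rw [truncGeom, Nat.add_sub_cancel, Fin.sum_univ_eq_sum_range
    (fun j => (PowerSeries.X : PowerSeries ℚ) ^ (j + 1)) e]
  simp only [pow_succ]
  rw [← Finset.sum_mul, ← mul_assoc, h]
  ring

section Recursion

variable {L : Type*} [CompleteLattice L] {r : L → ℕ} {𝒢 : Set L}

/-- The maximal elements of `𝒢` below `E`. -/
def factorsBelow (𝒢 : Set L) (E : L) : Set L := {G | Maximal (· ∈ {K ∈ 𝒢 | K ≤ E}) G}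

/-- The properties of building sets used for the recursion. -/
structure IsRankedBuildingSet (r : L → ℕ) (𝒢 : Set L) : Prop where
  ne_bot : ∀ G ∈ 𝒢, G ≠ ⊥
  exists_factor : ∀ E, E ≠ ⊥ → (factorsBelow 𝒢 E).Nonempty
  rank_sup : ∀ E, ∀ K ∈ factorsBelow 𝒢 E, ∀ A ≤ K, ∀ B ≤ sSup (factorsBelow 𝒢 E \ {K}),
    r (A ⊔ B) = r A + r B
  le_of_le_sup : ∀ E, ∀ K ∈ factorsBelow 𝒢 E, ∀ K' ∈ factorsBelow 𝒢 E, K ≠ K' → ∀ F ≤ E,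
    K ≤ K' ⊔ F → K ≤ F

section IntervalChar

variable [LocallyFiniteOrder L]

open Classical in
/-- The characteristic polynomial of the interval `[F, E]`. -/
noncomputable def intervalChar (r : L → ℕ) (F E : L) : Polynomial ℚ :=
  ∑ F' ∈ Finset.Icc F E, Polynomial.C (IncidenceAlgebra.mu ℚ F F') * Polynomial.X ^ (r E - r F')

theorem intervalChar_self (E : L) : intervalChar r E E = 1 := by
  simp [intervalChar]

theorem coe_intervalChar (F E : L) :
    letI := Classical.decEq L
    (intervalChar r F E : PowerSeries ℚ) = ∑ F' ∈ Finset.Icc F E,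
      PowerSeries.C (IncidenceAlgebra.mu ℚ F F') * PowerSeries.X ^ (r E - r F') := by
  rw [intervalChar, ← Polynomial.coeToPowerSeries.ringHom_apply, map_sum]
  refine Finset.sum_congr (by congr!) fun F' _ => ?_
  simp

end IntervalChar

variable [Fintype L]

theorem exists_le_factor {E K : L} (hK : K ∈ 𝒢) (hKE : K ≤ E) :
    ∃ K' ∈ factorsBelow 𝒢 E, K ≤ K' := by
  obtain ⟨K', h, h'⟩ := (Set.toFinite {K ∈ 𝒢 | K ≤ E}).exists_le_maximal ⟨hK, hKE⟩
  exact ⟨K', h', h⟩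

open Classical in
noncomputable def buildingFinset (𝒢 : Set L) (F : L) : Finset L :=
  Finset.univ.filter fun G => G ∈ 𝒢 ∧ G ≤ F

open Classical in
noncomputable def factorsFinset (𝒢 : Set L) (E : L) : Finset L :=
  Finset.univ.filter fun G => G ∈ factorsBelow 𝒢 E

@[simp]
theorem mem_buildingFinset {F G : L} : G ∈ buildingFinset 𝒢 F ↔ G ∈ 𝒢 ∧ G ≤ F := by
  simp [buildingFinset]

@[simp]
theorem mem_factorsFinset {E G : L} : G ∈ factorsFinset 𝒢 E ↔ G ∈ factorsBelow 𝒢 E := by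
  simp [factorsFinset]

open Classical in
/-- The generating series of the standard monomials with support `S`. -/
noncomputable def supportSeries (r : L → ℕ) (𝒢 : Set L) (S : Finset L) : PowerSeries ℚ :=
  -- The condition runs over all of `𝒢`, so the weight of `S` does not depend on the element below
  -- which `S` is taken.
  if ∀ G ∈ 𝒢, 1 ≤ relRank r S G then ∏ G ∈ S, truncGeom (relRank r S G) else 0

/-- The generating series of the standard monomials below `F`. -/
noncomputable def standardSeries (r : L → ℕ) (𝒢 : Set L) (F : L) : PowerSeries ℚ :=
  ∑ S ∈ (buildingFinset 𝒢 F).powerset, supportSeries r 𝒢 S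

open Classical in
-- As `K` is maximal in `𝒢` below `E`, it is strictly below no member of `S`, and their factors do
-- not change. A member of `𝒢` strictly above `K` is not below `E`, so a join of elements below `E`
-- never reaches it and its positivity condition is automatic.
theorem supportSeries_insert (hr : IsRankFunction r) {E K : L} (hK : K ∈ factorsBelow 𝒢 E)
    {S : Finset L} (hS : S ⊆ (buildingFinset 𝒢 E).erase K) :
    supportSeries r 𝒢 (insert K S) = truncGeom (relRank r S K) * supportSeries r 𝒢 S := by
  have hmax : ∀ G ∈ 𝒢, G ≤ E → ¬ K < G := fun G hG hGE h => hK.not_prop_of_gt h ⟨hG, hGE⟩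
  have hcongr : ∀ G, ¬ K < G → relRank r (insert K S : Finset L) G = relRank r S G :=
    fun G hG => relRank_congr fun K' hK' => by
      have : K' ≠ K := fun h => hG (h ▸ hK')
      simp [this]
  have hcond : (∀ G ∈ 𝒢, 1 ≤ relRank r (insert K S : Finset L) G) ↔
      ∀ G ∈ 𝒢, 1 ≤ relRank r S G := by
    refine forall₂_congr fun G hG => ?_
    by_cases hKG : K < G
    · have aux : ∀ T : Finset L, (∀ H ∈ T, H ≤ E) → 1 ≤ relRank r T G := fun T hT => by
        have h1 : supLT (T : Set L) G ≤ E := supLT_le_iff.2 fun H hH _ => hT H hH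
        have h2 : supLT (T : Set L) G < G := lt_of_le_of_ne (supLT_le _ _) fun h =>
          hmax G hG (h ▸ h1) hKG
        have := hr.strictMono h2
        rw [relRank]
        omega
      have hSE : ∀ H ∈ S, H ≤ E := fun H hH =>
        (mem_buildingFinset.1 (Finset.mem_of_mem_erase (hS hH))).2
      refine iff_of_true (aux _ fun H hH => ?_) (aux _ hSE)
      rcases Finset.mem_insert.1 hH with rfl | hH
      · exact hK.prop.2
      · exact hSE H hH
    · rw [hcongr G hKG]
  rw [supportSeries, supportSeries, mul_ite, mul_zero]
  refine if_congr hcond ?_ rfl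
  rw [Finset.prod_insert fun h => Finset.notMem_erase K _ (hS h), hcongr K (lt_irrefl K)]
  congr 1
  refine Finset.prod_congr rfl fun G hG => ?_
  have := mem_buildingFinset.1 (Finset.mem_of_mem_erase (hS hG))
  rw [hcongr G (hmax G this.1 this.2)]

open Classical in
-- The join splits as `A ⊔ B`, where `A ≤ K` comes from the elements of `S` strictly below `K` and
-- `B` lies below the join of the other factors. Rank is additive across this splitting, so
-- adjoining `K` only replaces `r A` by `r K`.
theorem rank_sup_factor (hr : IsRankFunction r) (h𝒢 : IsRankedBuildingSet r 𝒢) {E K : L}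
    (hK : K ∈ factorsBelow 𝒢 E) {S T : Finset L} (hS : S ⊆ (buildingFinset 𝒢 E).erase K)
    (hT : T ⊆ (factorsFinset 𝒢 E).erase K) :
    r (K ⊔ (S.sup id ⊔ T.sup id)) = r (S.sup id ⊔ T.sup id) + relRank r S K := by
  set A := supLT (S : Set L) K with hA
  set B := (S.filter fun G => ¬ G < K).sup id ⊔ T.sup id with hB
  have hAK : A ≤ K := supLT_le _ _
  have hBle : B ≤ sSup (factorsBelow 𝒢 E \ {K}) := by
    refine sup_le (Finset.sup_le fun G hG => ?_) (Finset.sup_le fun G hG => le_sSup ?_)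
    · obtain ⟨hGS, hGK⟩ := Finset.mem_filter.1 hG
      obtain ⟨hne, hG'⟩ := Finset.mem_erase.1 (hS hGS)
      obtain ⟨K', hK', hle⟩ := exists_le_factor (mem_buildingFinset.1 hG').1
        (mem_buildingFinset.1 hG').2
      refine le_sSup_of_le ⟨hK', fun h => ?_⟩ hle
      exact hGK (lt_of_le_of_ne (h ▸ hle) hne)
    · obtain ⟨hne, hG'⟩ := Finset.mem_erase.1 (hT hG)
      exact ⟨mem_factorsFinset.1 hG', hne⟩
  have hsup : S.sup id ⊔ T.sup id = A ⊔ B := by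
    apply le_antisymm
    · refine sup_le (Finset.sup_le fun G hG => ?_) (le_sup_of_le_right le_sup_right)
      by_cases h : G < K
      · exact le_sup_of_le_left (le_supLT hG h)
      · exact le_sup_of_le_right (le_sup_of_le_left
          (Finset.le_sup (f := id) (Finset.mem_filter.2 ⟨hG, h⟩)))
    · refine sup_le (supLT_le_iff.2 fun G hG _ => le_sup_of_le_left (Finset.le_sup (f := id) hG))
        (sup_le_sup_right (Finset.sup_mono (Finset.filter_subset _ _)) _)
  have h1 := h𝒢.rank_sup E K hK A hAK B hBle
  have h2 := h𝒢.rank_sup E K hK K le_rfl B hBle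
  have h3 := hr.strictMono.monotone hAK
  rw [hsup, ← sup_assoc, sup_eq_left.2 hAK, h1, h2, relRank, ← hA]
  omega

/-- Adding or removing a factor of `E` cancels all terms. -/
theorem sum_supportSeries_eq_zero (hr : IsRankFunction r) (h𝒢 : IsRankedBuildingSet r 𝒢) {E : L}
    (hE : E ≠ ⊥) :
    ∑ S ∈ (buildingFinset 𝒢 E).powerset, ∑ T ∈ (factorsFinset 𝒢 E).powerset,
      supportSeries r 𝒢 S * (-PowerSeries.X) ^ T.card *
        PowerSeries.X ^ (r E - r (S.sup id ⊔ T.sup id)) = 0 := by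
  classical
  obtain ⟨K, hK⟩ := h𝒢.exists_factor E hE
  have hK1 : K ∈ buildingFinset 𝒢 E := mem_buildingFinset.2 hK.prop
  have hK2 : K ∈ factorsFinset 𝒢 E := mem_factorsFinset.2 hK
  rw [← Finset.insert_erase hK1, ← Finset.insert_erase hK2,
    Finset.sum_powerset_insert (Finset.notMem_erase _ _)]
  simp only [Finset.sum_powerset_insert (Finset.notMem_erase _ _)]
  simp only [← Finset.sum_add_distrib]
  refine Finset.sum_eq_zero fun S hS => Finset.sum_eq_zero fun T hT => ?_
  rw [Finset.mem_powerset] at hS hT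
  have hrank := rank_sup_factor hr h𝒢 hK hS hT
  have hKT : K ∉ T := fun h => Finset.notMem_erase K _ (hT h)
  have e1 : S.sup id ⊔ (insert K T).sup id = K ⊔ (S.sup id ⊔ T.sup id) := by
    rw [Finset.sup_insert, id, sup_left_comm]
  have e2 : (insert K S).sup id ⊔ T.sup id = K ⊔ (S.sup id ⊔ T.sup id) := by
    rw [Finset.sup_insert, id, sup_assoc]
  have e3 : (insert K S).sup id ⊔ (insert K T).sup id = K ⊔ (S.sup id ⊔ T.sup id) := by
    rw [Finset.sup_insert, sup_assoc, e1, id, ← sup_assoc, sup_idem]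
  rw [e1, e2, e3, supportSeries_insert hr hK hS, Finset.card_insert_of_notMem hKT]
  by_cases hw : supportSeries r 𝒢 S = 0
  · simp [hw]
  -- The geometric sum identity fails for `d = 0`; a nonzero weight excludes this case.
  have hd : 1 ≤ relRank r S K := by
    by_contra hd
    exact hw (if_neg fun h => hd (h K hK.prop.1))
  have hle : K ⊔ (S.sup id ⊔ T.sup id) ≤ E := by
    refine sup_le hK.prop.2 (sup_le (Finset.sup_le fun G hG => ?_) (Finset.sup_le fun G hG => ?_))
    · exact (mem_buildingFinset.1 (Finset.mem_of_mem_erase (hS hG))).2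
    · exact (mem_factorsFinset.1 (Finset.mem_of_mem_erase (hT hG))).prop.2
  have hle' := hr.strictMono.monotone hle
  have hexp : r E - r (S.sup id ⊔ T.sup id) =
      (r E - r (K ⊔ (S.sup id ⊔ T.sup id))) + relRank r S K := by omega
  rw [hexp, pow_add, pow_succ]
  -- Up to a common factor the four terms are `X ^ d`, `-X`, `t` and `-X * t`, with `d = relRank r S
  -- K` and `t = truncGeom d`.
  have ht := one_sub_mul_truncGeom hd
  linear_combination (supportSeries r 𝒢 S * (-PowerSeries.X) ^ T.card *
    PowerSeries.X ^ (r E - r (K ⊔ (S.sup id ⊔ T.sup id)))) * ht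

theorem standardSeries_bot (hr : IsRankFunction r) (h𝒢 : IsRankedBuildingSet r 𝒢) :
    standardSeries r 𝒢 ⊥ = 1 := by
  have h : buildingFinset 𝒢 ⊥ = ∅ := by
    ext G
    simp only [mem_buildingFinset, le_bot_iff, Finset.notMem_empty, iff_false, not_and]
    exact h𝒢.ne_bot G
  rw [standardSeries, h, Finset.powerset_empty, Finset.sum_singleton, supportSeries, if_pos,
    Finset.prod_empty]
  intro G hG
  have := hr.strictMono (bot_lt_iff_ne_bot.2 (h𝒢.ne_bot G hG))
  have h0 : supLT ((∅ : Finset L) : Set L) G = ⊥ := by simp [supLT]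
  rw [relRank, h0]
  omega

open Classical in
-- The power of `1 - X` is expanded over sets `T` of factors of `E` below `F`. Afterwards `F` enters
-- only through one inequality, so the sum over `F` can be carried out for fixed `S` and `T`.
theorem standardSeries_mul {E F : L} (hF : F ≤ E) :
    standardSeries r 𝒢 F * (1 - PowerSeries.X) ^ ((factorsFinset 𝒢 E).filter (· ≤ F)).card =
      ∑ S ∈ (buildingFinset 𝒢 E).powerset, ∑ T ∈ (factorsFinset 𝒢 E).powerset,
        if S.sup id ⊔ T.sup id ≤ F then
          supportSeries r 𝒢 S * (-PowerSeries.X) ^ T.card else 0 := by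
  have h1 : (1 - PowerSeries.X : PowerSeries ℚ) ^ ((factorsFinset 𝒢 E).filter (· ≤ F)).card =
      ∑ T ∈ (factorsFinset 𝒢 E).powerset,
        if T.sup id ≤ F then (-PowerSeries.X : PowerSeries ℚ) ^ T.card else 0 := by
    rw [← Finset.sum_filter, sub_eq_neg_add, ← Finset.sum_pow_mul_eq_add_pow]
    simp only [one_pow, mul_one]
    refine Finset.sum_congr ?_ fun _ _ => rfl
    ext T
    simp only [Finset.mem_powerset, Finset.mem_filter, Finset.sup_le_iff, id]
    exact ⟨fun h => ⟨fun x hx => (Finset.mem_filter.1 (h hx)).1,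
      fun x hx => (Finset.mem_filter.1 (h hx)).2⟩,
      fun h x hx => Finset.mem_filter.2 ⟨h.1 hx, h.2 x hx⟩⟩
  have h2 : standardSeries r 𝒢 F = ∑ S ∈ (buildingFinset 𝒢 E).powerset,
      if S.sup id ≤ F then supportSeries r 𝒢 S else 0 := by
    rw [← Finset.sum_filter, standardSeries]
    refine Finset.sum_congr ?_ fun _ _ => rfl
    ext S
    simp only [Finset.mem_powerset, Finset.mem_filter, Finset.sup_le_iff, id]
    refine ⟨fun h => ⟨fun x hx => ?_, fun x hx => (mem_buildingFinset.1 (h hx)).2⟩,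
      fun h x hx => mem_buildingFinset.2 ⟨(mem_buildingFinset.1 (h.1 hx)).1, h.2 x hx⟩⟩
    have := mem_buildingFinset.1 (h hx)
    exact mem_buildingFinset.2 ⟨this.1, this.2.trans hF⟩
  rw [h1, h2, Finset.sum_mul_sum]
  refine Finset.sum_congr rfl fun S _ => Finset.sum_congr rfl fun T _ => ?_
  by_cases hS : S.sup id ≤ F <;> by_cases hT : T.sup id ≤ F <;> simp [hS, hT]

variable [LocallyFiniteOrder L]

open Classical in
-- Möbius inversion: after the sums are exchanged, the inner sum of `μ(F, F')` over `A ≤ F ≤ F'`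
-- vanishes unless `F' = A`.
theorem sum_intervalChar {A E : L} (hA : A ≤ E) :
    ∑ F : L with F ≤ E, (if A ≤ F then (intervalChar r F E : PowerSeries ℚ) else 0) =
      PowerSeries.X ^ (r E - r A) := by
  have h1 : ∑ F : L with F ≤ E, (if A ≤ F then (intervalChar r F E : PowerSeries ℚ) else 0) =
      ∑ F ∈ Finset.Icc A E, ∑ F' ∈ Finset.Icc F E,
        PowerSeries.C (IncidenceAlgebra.mu ℚ F F') * PowerSeries.X ^ (r E - r F') := by
    rw [← Finset.sum_filter, Finset.filter_filter]
    refine Finset.sum_congr ?_ fun F _ => ?_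
    · ext F
      simp [and_comm]
    · rw [coe_intervalChar]
  have h2 : ∑ F ∈ Finset.Icc A E, ∑ F' ∈ Finset.Icc F E,
        (PowerSeries.C (IncidenceAlgebra.mu ℚ F F') * PowerSeries.X ^ (r E - r F') :
          PowerSeries ℚ) =
      ∑ F' ∈ Finset.Icc A E, ∑ F ∈ Finset.Icc A F',
        PowerSeries.C (IncidenceAlgebra.mu ℚ F F') * PowerSeries.X ^ (r E - r F') := by
    refine Finset.sum_comm' fun F F' => ?_
    simp only [Finset.mem_Icc]
    exact ⟨fun h => ⟨⟨h.1.1, h.2.1⟩, h.1.1.trans h.2.1, h.2.2⟩,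
      fun h => ⟨⟨h.1.1, h.1.2.trans h.2.2⟩, h.1.2, h.2.2⟩⟩
  rw [h1, h2]
  simp only [← Finset.sum_mul, ← map_sum, IncidenceAlgebra.sum_Icc_mu_left]
  rw [Finset.sum_eq_single A]
  · simp
  · intro F' _ hne
    simp [hne.symm]
  · simp [hA]

open Classical in
-- This is the recursion with denominators cleared: summing over `F` first turns it into the
-- cancellation of `sum_supportSeries_eq_zero`.
theorem sum_standardSeries_mul_intervalChar (hr : IsRankFunction r)
    (h𝒢 : IsRankedBuildingSet r 𝒢) {E : L} (hE : E ≠ ⊥) :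
    ∑ F : L with F ≤ E, standardSeries r 𝒢 F *
      (1 - PowerSeries.X) ^ ((factorsFinset 𝒢 E).filter (· ≤ F)).card *
        (intervalChar r F E : PowerSeries ℚ) = 0 := by
  rw [← sum_supportSeries_eq_zero hr h𝒢 hE]
  rw [Finset.sum_congr rfl fun F hF => by rw [standardSeries_mul (Finset.mem_filter.1 hF).2]]
  simp only [Finset.sum_mul]
  rw [Finset.sum_comm]
  refine Finset.sum_congr rfl fun S hS => ?_
  rw [Finset.sum_comm]
  refine Finset.sum_congr rfl fun T hT => ?_
  rw [Finset.mem_powerset] at hS hT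
  have hle : S.sup id ⊔ T.sup id ≤ E := sup_le
    (Finset.sup_le fun G hG => (mem_buildingFinset.1 (hS hG)).2)
    (Finset.sup_le fun G hG => (mem_factorsFinset.1 (hT hG)).prop.2)
  rw [← sum_intervalChar hle, Finset.mul_sum]
  refine Finset.sum_congr rfl fun F _ => ?_
  split_ifs <;> simp

open Classical in
/-- The factor `χ_{[F, E]} / (1 - x) ^ n`, where `n` is the number of factors of `E` not below
`F`. -/
noncomputable def intervalSeries (r : L → ℕ) (𝒢 : Set L) (F E : L) : PowerSeries ℚ :=
  (intervalChar r F E : PowerSeries ℚ) *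
    ((1 - PowerSeries.X) ^ ((factorsFinset 𝒢 E).filter (¬ · ≤ F)).card)⁻¹

open Classical in
-- Dividing by the power of `1 - X` for all factors of `E` leaves those not below `F` in the
-- denominator. The term `F = E` is the series of `E` itself.
theorem standardSeries_rec (hr : IsRankFunction r) (h𝒢 : IsRankedBuildingSet r 𝒢) {E : L}
    (hE : E ≠ ⊥) : standardSeries r 𝒢 E =
      -∑ F : L with F < E, standardSeries r 𝒢 F * intervalSeries r 𝒢 F E := by
  have h1 : ∀ n : ℕ, ((1 - PowerSeries.X : PowerSeries ℚ) ^ n) * ((1 - PowerSeries.X) ^ n)⁻¹ = 1 :=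
    fun n => PowerSeries.mul_inv_cancel _ (by simp)
  have hterm : ∀ F ∈ Finset.univ.filter (fun F : L => F ≤ E),
      standardSeries r 𝒢 F * intervalSeries r 𝒢 F E =
      standardSeries r 𝒢 F *
        (1 - PowerSeries.X) ^ ((factorsFinset 𝒢 E).filter (· ≤ F)).card *
        (intervalChar r F E : PowerSeries ℚ) *
          ((1 - PowerSeries.X) ^ (factorsFinset 𝒢 E).card)⁻¹ := fun F _ => by
    rw [intervalSeries, ← Finset.card_filter_add_card_filter_not (s := factorsFinset 𝒢 E) (· ≤ F),
      pow_add, PowerSeries.mul_inv_rev]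
    linear_combination -(standardSeries r 𝒢 F * (intervalChar r F E : PowerSeries ℚ) *
      ((1 - PowerSeries.X) ^ ((factorsFinset 𝒢 E).filter (¬ · ≤ F)).card)⁻¹) *
        h1 ((factorsFinset 𝒢 E).filter (· ≤ F)).card
  have h0 : ∑ F : L with F ≤ E, standardSeries r 𝒢 F * intervalSeries r 𝒢 F E = 0 := by
    rw [Finset.sum_congr rfl hterm, ← Finset.sum_mul,
      sum_standardSeries_mul_intervalChar hr h𝒢 hE, zero_mul]
  have hfil : (Finset.univ.filter fun F : L => F ≤ E) =
      insert E (Finset.univ.filter fun F : L => F < E) := by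
    ext F
    simp [le_iff_eq_or_lt]
  have hself : intervalSeries r 𝒢 E E = 1 := by
    have : (factorsFinset 𝒢 E).filter (¬ · ≤ E) = ∅ :=
      Finset.filter_eq_empty_iff.2 fun K hK => not_not.2 (mem_factorsFinset.1 hK).prop.2
    rw [intervalSeries, intervalChar_self, this]
    simp
  rw [hfil, Finset.sum_insert (by simp), hself, mul_one] at h0
  exact eq_neg_of_add_eq_zero_left h0

end Recursion

/-! ### Flats of a loopless polymatroid -/

namespace Polymatroid

variable {α : Type*} [DecidableEq α] {M : Polymatroid α}

theorem Flat.ext {F G : M.Flat} (h : F.set = G.set) : F = G := Subtype.ext h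

/-- Every set is contained in a flat of the same rank. -/
theorem exists_flat (M : Polymatroid α) {A : Finset α} (hA : A ⊆ M.ground) :
    ∃ F : M.Flat, A ⊆ F.set ∧ M.rk F.set = M.rk A := by
  obtain ⟨B, hAB, hB⟩ := (Set.toFinite {B : Finset α | B ∈ M.ground.powerset ∧ A ⊆ B ∧
    M.rk B = M.rk A}).exists_le_maximal ⟨Finset.mem_powerset.2 hA, subset_rfl, rfl⟩
  obtain ⟨hBE, -, hrk⟩ := hB.prop
  rw [Finset.mem_powerset] at hBE
  refine ⟨⟨B, hBE, fun e he => ?_⟩, hAB, hrk⟩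
  obtain ⟨he, heB⟩ := Finset.mem_sdiff.1 he
  have hins : insert e B ⊆ M.ground := Finset.insert_subset he hBE
  refine lt_of_le_of_ne (M.rk_mono _ _ (Finset.subset_insert _ _) hins) fun h => heB ?_
  exact hB.le_of_ge ⟨Finset.mem_powerset.2 hins, hAB.trans (Finset.subset_insert _ _),
    h.symm.trans hrk⟩ (Finset.subset_insert _ _) (Finset.mem_insert_self _ _)

theorem Loopless.bot_set (hM : M.Loopless) : (⊥ : M.Flat).set = ∅ :=
  Finset.subset_empty.1 (Flat.le_iff.1 (bot_le (α := M.Flat) (a := ⟨∅, hM⟩)))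

theorem top_set (M : Polymatroid α) : (⊤ : M.Flat).set = M.ground := by
  refine (⊤ : M.Flat).subset_ground.antisymm ?_
  let G : M.Flat := ⟨M.ground, subset_rfl, fun e he => by simp at he⟩
  exact Flat.le_iff.1 (le_top : G ≤ ⊤)

theorem isRankFunction (hM : M.Loopless) : IsRankFunction fun F : M.Flat => M.rk F.set where
  strictMono F G h := by
    obtain ⟨hle, hne⟩ := h
    obtain ⟨e, heG, heF⟩ := Finset.not_subset.1 hne
    have heE := G.subset_ground heG
    exact (F.2.rk_lt e (Finset.mem_sdiff.2 ⟨heE, heF⟩)).trans_le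
      (M.rk_mono _ _ (Finset.insert_subset heG hle) G.subset_ground)
  submod F G := by
    -- The join of two flats may be larger than their union, but it lies in a flat with the rank of
    -- the union.
    obtain ⟨H, hH, hrk⟩ := M.exists_flat (Finset.union_subset F.subset_ground G.subset_ground)
    have h1 : F ⊔ G ≤ H := sup_le (Finset.subset_union_left.trans hH)
      (Finset.subset_union_right.trans hH)
    have h2 : (F ⊓ G).set ⊆ F.set ∩ G.set :=
      Finset.subset_inter (inf_le_left (a := F) (b := G)) (inf_le_right (a := F) (b := G))
    have h3 := M.rk_mono _ _ h1 H.subset_ground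
    have h4 := M.rk_mono _ _ h2 (Finset.inter_subset_left.trans F.subset_ground)
    have h5 := M.rk_submod F.set G.set F.subset_ground G.subset_ground
    have h6 : M.rk (F ⊔ G).set ≤ M.rk H.set := h3
    omega
  bot := by rw [hM.bot_set, M.rk_empty]

/-! ### Consequences of the product decomposition -/

namespace IsBuildingSet

variable {𝒢 : Set M.Flat}

/-- The family with entry `X` at `K` and `⊥` elsewhere has join `X`; the isomorphism reflects the
order, so the comparison holds coordinatewise. -/
theorem le_of_le_iSup (h𝒢 : M.IsBuildingSet 𝒢) {E : M.Flat} (y : (G : factors (below 𝒢 E)) → Set.Iic G.1)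
    (K : factors (below 𝒢 E)) {X : M.Flat} (hXK : X ≤ K) (hX : X ≤ ⨆ G, (y G : M.Flat)) :
    X ≤ y K := by
  classical
  obtain ⟨φ, hφ⟩ := h𝒢.factor_iso E
  let y' : (G : factors (below 𝒢 E)) → Set.Iic G.1 := Function.update ⊥ K ⟨X, hXK⟩
  have h : φ y' ≤ φ y := by
    rw [← Subtype.coe_le_coe, hφ, hφ]
    refine iSup_le fun G => ?_
    by_cases hG : G = K
    · subst hG
      simpa [y'] using hX
    · simp [y', hG]
  have := φ.le_iff_le.1 h K
  simpa [y', ← Subtype.coe_le_coe] using this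

theorem exists_eq_iSup (h𝒢 : M.IsBuildingSet 𝒢) {E F : M.Flat} (hF : F ≤ E) :
    ∃ y : (G : factors (below 𝒢 E)) → Set.Iic G.1, F = ⨆ G, (y G : M.Flat) := by
  classical
  obtain ⟨φ, hφ⟩ := h𝒢.factor_iso E
  exact ⟨φ.symm ⟨F, hF⟩, by rw [← hφ]; simp⟩

theorem eq_iSup_factors (h𝒢 : M.IsBuildingSet 𝒢) (E : M.Flat) : E = ⨆ G : factors (below 𝒢 E), (G : M.Flat) := by
  obtain ⟨y, hy⟩ := h𝒢.exists_eq_iSup (le_refl E)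
  refine le_antisymm ?_ (iSup_le fun G => G.2.prop.2)
  nth_rewrite 1 [hy]
  exact iSup_mono fun G => (y G).2

/-- Joining `F` with `K'` changes only the coordinate of `F` at `K'`, while a flat below `K` is
tested at the coordinate `K`. -/
theorem le_of_le_sup (h𝒢 : M.IsBuildingSet 𝒢) {E : M.Flat} {K K' : M.Flat} (hK : K ∈ factors (below 𝒢 E))
    (hK' : K' ∈ factors (below 𝒢 E)) (hne : K ≠ K') {X F : M.Flat} (hF : F ≤ E) (hXK : X ≤ K)
    (hX : X ≤ K' ⊔ F) : X ≤ F := by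
  classical
  obtain ⟨y, rfl⟩ := h𝒢.exists_eq_iSup hF
  have h := h𝒢.le_of_le_iSup (Function.update y ⟨K', hK'⟩ ⟨K', le_refl K'⟩) ⟨K, hK⟩ hXK
    (hX.trans (sup_le ?_ (iSup_le fun G => ?_)))
  · rw [Function.update_of_ne (by simpa using hne)] at h
    exact h.trans (le_iSup (fun G => (y G : M.Flat)) ⟨K, hK⟩)
  · exact le_iSup_of_le ⟨K', hK'⟩ (by simp)
  · by_cases hG : G = ⟨K', hK'⟩
    · subst hG
      exact le_iSup_of_le ⟨K', hK'⟩ (by rw [Function.update_self]; exact (y ⟨K', hK'⟩).2)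
    · exact le_iSup_of_le G (by simp [hG])

theorem ne_bot (h𝒢 : M.IsBuildingSet 𝒢) (hM : M.Loopless) {G : M.Flat} (hG : G ∈ 𝒢) : G ≠ ⊥ := by
  rintro rfl
  simpa [hM.bot_set] using h𝒢.nonempty _ hG

/-- Take factors of `G ⊔ H` containing `G` and `H`. If they coincide, they equal `G ⊔ H`; if not, `G
⊓ H` lies below two distinct factors and is `⊥`. -/
theorem sup_mem (h𝒢 : M.IsBuildingSet 𝒢) {G H : M.Flat} (hG : G ∈ 𝒢) (hH : H ∈ 𝒢) (hGH : G ⊓ H ≠ ⊥) : G ⊔ H ∈ 𝒢 := by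
  obtain ⟨K, hK, hGK⟩ := exists_le_factor hG (le_sup_left : G ≤ G ⊔ H)
  obtain ⟨K', hK', hHK⟩ := exists_le_factor hH (le_sup_right : H ≤ G ⊔ H)
  by_cases hne : K = K'
  · subst hne
    have : G ⊔ H = K := le_antisymm (sup_le hGK hHK) hK.prop.2
    exact this ▸ hK.prop.1
  · refine absurd (le_bot_iff.1 (h𝒢.le_of_le_sup hK hK' hne bot_le (inf_le_left.trans hGK) ?_)) hGH
    exact (inf_le_right.trans hHK).trans le_sup_left

/-- The rank condition forces equality in `r E ≤ r K + r C`, with `C` the join of the other factors.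
Submodularity then passes additivity from `(K, C)` to `(K, B)` and on to `(A, B)`. -/
theorem rank_sup (h𝒢 : M.IsBuildingSet 𝒢) (hM : M.Loopless) {E K : M.Flat} (hK : K ∈ factors (below 𝒢 E)) {A B : M.Flat}
    (hA : A ≤ K) (hB : B ≤ sSup (factors (below 𝒢 E) \ {K})) :
    M.rk (A ⊔ B).set = M.rk A.set + M.rk B.set := by
  classical
  have hr := isRankFunction hM
  set r := fun F : M.Flat => M.rk F.set with hrdef
  change r (A ⊔ B) = r A + r B
  set C := sSup (factors (below 𝒢 E) \ {K}) with hC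
  have hsup : ∀ s : Finset M.Flat, r (s.sup id) ≤ ∑ G ∈ s, r G := fun s => by
    induction s using Finset.induction_on with
    | empty => simp [hr.bot]
    | insert a s ha ih =>
      rw [Finset.sup_insert, Finset.sum_insert ha, id]
      have := hr.submod a (s.sup id)
      omega
  have hKf : K ∈ factorsFinset 𝒢 E := mem_factorsFinset.2 hK
  have hrE : r E = r K + ∑ G ∈ (factorsFinset 𝒢 E).erase K, r G := by
    rw [Finset.add_sum_erase _ _ hKf]
    refine (h𝒢.rk_eq E).trans ?_
    exact (Finset.sum_subtype (factorsFinset 𝒢 E) (fun x => mem_factorsFinset) r).symm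
  have hrC : r C ≤ ∑ G ∈ (factorsFinset 𝒢 E).erase K, r G := by
    refine (hr.strictMono.monotone (sSup_le fun G hG => ?_)).trans (hsup _)
    exact Finset.le_sup (f := id)
      (Finset.mem_erase.2 ⟨hG.2, mem_factorsFinset.2 hG.1⟩)
  have hKC : E ≤ K ⊔ C := by
    refine (h𝒢.eq_iSup_factors E).le.trans (iSup_le fun G => ?_)
    by_cases hG : G.1 = K
    · exact hG ▸ le_sup_left
    · exact le_sup_of_le_right (le_sSup ⟨G.2, hG⟩)
  have h1 := hr.strictMono.monotone hKC
  have h2 := hr.submod (K ⊔ B) C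
  have h3 : K ⊔ B ⊔ C = K ⊔ C := by rw [sup_assoc, sup_eq_right.2 hB]
  have h4 := hr.strictMono.monotone (le_inf (le_sup_right : B ≤ K ⊔ B) hB)
  have h5 := hr.submod (A ⊔ B) K
  have h6 : A ⊔ B ⊔ K = K ⊔ B := by
    rw [sup_right_comm, sup_eq_right.2 hA]
  have h7 := hr.strictMono.monotone (le_inf (le_sup_left : A ≤ A ⊔ B) hA)
  have h8 := hr.submod A B
  rw [h3] at h2
  rw [h6] at h5
  omega

theorem isRankedBuildingSet (h𝒢 : M.IsBuildingSet 𝒢) (hM : M.Loopless) :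
    IsRankedBuildingSet (fun F : M.Flat => M.rk F.set) 𝒢 where
  ne_bot _ hG := h𝒢.ne_bot hM hG
  exists_factor E hE := by
    by_contra h
    have : IsEmpty (factors (below 𝒢 E)) := Set.isEmpty_coe_sort.2 (Set.not_nonempty_iff_eq_empty.1 h)
    exact hE ((h𝒢.eq_iSup_factors E).trans (iSup_of_empty _))
  rank_sup _ _ hK _ hA _ hB := h𝒢.rank_sup hM hK hA hB
  le_of_le_sup _ _ hK _ hK' hne _ hF h := h𝒢.le_of_le_sup hK hK' hne hF le_rfl h

end IsBuildingSet

end Polymatroid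

/-! ### Minors -/

/-- The Möbius function is invariant under embeddings whose image is convex. -/
theorem IncidenceAlgebra.mu_map {P L : Type*} [PartialOrder P] [PartialOrder L]
    [LocallyFiniteOrder P] [LocallyFiniteOrder L] [DecidableEq P] [DecidableEq L] [Finite P]
    (φ : P ↪o L) (hφ : ∀ a : P, ∀ x : L, φ a ≤ x → (∃ b, x ≤ φ b) → ∃ b, φ b = x) (a b : P) :
    mu ℚ (φ a) (φ b) = mu ℚ a b := by
  induction b using WellFoundedLT.induction with
  | ind b ih =>
    rw [mu_apply, mu_apply]
    refine if_congr φ.injective.eq_iff rfl ?_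
    have : Finset.Ico (φ a) (φ b) = (Finset.Ico a b).map φ.toEmbedding := by
      ext x
      simp only [Finset.mem_Ico, Finset.mem_map, RelEmbedding.coe_toEmbedding]
      constructor
      · rintro ⟨h1, h2⟩
        obtain ⟨c, rfl⟩ := hφ a x h1 ⟨b, h2.le⟩
        exact ⟨c, ⟨φ.le_iff_le.1 h1, φ.lt_iff_lt.1 h2⟩, rfl⟩
      · rintro ⟨c, ⟨h1, h2⟩, rfl⟩
        exact ⟨φ.le_iff_le.2 h1, φ.lt_iff_lt.2 h2⟩
    rw [this, Finset.sum_map]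
    congr 1
    exact Finset.sum_congr rfl fun c hc => ih c (Finset.mem_Ico.1 hc).2

namespace Polymatroid

variable {α : Type*} [DecidableEq α] {M : Polymatroid α}

/-- An element outside `G` raises the rank of `G`, hence by submodularity that of every subset of
`G`. -/
theorem isFlat_of_restrict {G : M.Flat} {A : Finset α} (hA : (M.restrict G).IsFlat A) :
    M.IsFlat A := by
  have hAG : A ⊆ G.set := hA.subset_ground
  refine ⟨hAG.trans G.subset_ground, fun e he => ?_⟩
  obtain ⟨he, heA⟩ := Finset.mem_sdiff.1 he
  by_cases heG : e ∈ G.set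
  · exact hA.rk_lt e (Finset.mem_sdiff.2 ⟨heG, heA⟩)
  · exact M.rk_lt_insert_of_subset hAG G.subset_ground he
      (G.2.rk_lt e (Finset.mem_sdiff.2 ⟨he, heG⟩)) heG

theorem sup_set_restrict {E : M.Flat} {G H : (M.restrict E).Flat} {K F : M.Flat}
    (hG : G.set = K.set) (hH : H.set = F.set) : (G ⊔ H).set = (K ⊔ F).set := by
  have hK : K ≤ E := Flat.le_iff.2 (hG ▸ G.subset_ground)
  have hF : F ≤ E := Flat.le_iff.2 (hH ▸ H.subset_ground)
  apply subset_antisymm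
  · refine Flat.le_iff.1 (sup_le (c := (K ⊔ F).toRestrict E (sup_le hK hF)) ?_ ?_)
    · exact Flat.le_iff.2 (hG.le.trans (Flat.le_iff.1 (le_sup_left : K ≤ K ⊔ F)))
    · exact Flat.le_iff.2 (hH.le.trans (Flat.le_iff.1 (le_sup_right : F ≤ K ⊔ F)))
  · let J : M.Flat := ⟨(G ⊔ H).set, isFlat_of_restrict (G ⊔ H).2⟩
    refine Flat.le_iff.1 (sup_le (c := J) ?_ ?_)
    · exact Flat.le_iff.2 (hG.ge.trans (Flat.le_iff.1 (le_sup_left : G ≤ G ⊔ H)))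
    · exact Flat.le_iff.2 (hH.ge.trans (Flat.le_iff.1 (le_sup_right : H ≤ G ⊔ H)))

section Minor

variable {F E : M.Flat} (h : F ≤ E)

theorem isFlat_union_of_minor {A : Finset α} (hA : (M.minor F E h).IsFlat A) :
    M.IsFlat (A ∪ F.set) := by
  have hAE : A ⊆ E.set \ F.set := hA.subset_ground
  have hAE' : A ∪ F.set ⊆ E.set := Finset.union_subset (hAE.trans Finset.sdiff_subset) h
  refine isFlat_of_restrict (G := E) ⟨hAE', fun e he => ?_⟩
  obtain ⟨he, heA⟩ := Finset.mem_sdiff.1 he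
  rw [Finset.mem_union, not_or] at heA
  have h1 : M.rk (A ∪ F.set) - M.rk F.set < M.rk (insert e A ∪ F.set) - M.rk F.set :=
    hA.rk_lt e (Finset.mem_sdiff.2 ⟨Finset.mem_sdiff.2 ⟨he, heA.2⟩, heA.1⟩)
  rw [Finset.insert_union] at h1
  change M.rk (A ∪ F.set) < M.rk (insert e (A ∪ F.set))
  omega

theorem isFlat_minor_sdiff {H : M.Flat} (hFH : F ≤ H) (hHE : H ≤ E) :
    (M.minor F E h).IsFlat (H.set \ F.set) := by
  refine ⟨Finset.sdiff_subset_sdiff hHE subset_rfl, fun e he => ?_⟩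
  obtain ⟨he, heH⟩ := Finset.mem_sdiff.1 he
  obtain ⟨heE, heF⟩ := Finset.mem_sdiff.1 (show e ∈ E.set \ F.set from he)
  have heH' : e ∉ H.set := fun h' => heH (Finset.mem_sdiff.2 ⟨h', heF⟩)
  have h1 := H.2.rk_lt e (Finset.mem_sdiff.2 ⟨E.subset_ground heE, heH'⟩)
  change M.rk (H.set \ F.set ∪ F.set) - M.rk F.set <
    M.rk (insert e (H.set \ F.set) ∪ F.set) - M.rk F.set
  rw [Finset.insert_union, Finset.sdiff_union_of_subset (Flat.le_iff.1 hFH)]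
  have h2 := M.rk_mono F.set H.set hFH H.subset_ground
  change M.rk H.set < M.rk (insert e H.set) at h1
  omega

/-- A flat `A` of the minor `M|_E/F`, regarded as the flat `A ∪ F` of `M`. -/
def ofMinor : (M.minor F E h).Flat ↪o M.Flat where
  toFun A := ⟨A.set ∪ F.set, isFlat_union_of_minor h A.2⟩
  inj' A B hAB := by
    have hA : Disjoint A.set F.set :=
      Finset.disjoint_of_subset_left A.subset_ground Finset.sdiff_disjoint
    have hB : Disjoint B.set F.set :=
      Finset.disjoint_of_subset_left B.subset_ground Finset.sdiff_disjoint
    have : A.set ∪ F.set = B.set ∪ F.set := congrArg Flat.set hAB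
    apply Flat.ext
    rw [← Finset.union_sdiff_cancel_right hA, this, Finset.union_sdiff_cancel_right hB]
  map_rel_iff' {A B} := by
    have hA : Disjoint A.set F.set :=
      Finset.disjoint_of_subset_left A.subset_ground Finset.sdiff_disjoint
    change A.set ∪ F.set ⊆ B.set ∪ F.set ↔ A.set ⊆ B.set
    refine ⟨fun h' => ?_, fun h' => Finset.union_subset_union_left h'⟩
    exact hA.left_le_of_le_sup_right (Finset.subset_union_left.trans h')

theorem ofMinor_set (A : (M.minor F E h).Flat) : (ofMinor h A).set = A.set ∪ F.set := rfl

theorem le_ofMinor (A : (M.minor F E h).Flat) : F ≤ ofMinor h A :=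
  Flat.le_iff.2 Finset.subset_union_right

theorem ofMinor_le (A : (M.minor F E h).Flat) : ofMinor h A ≤ E :=
  Flat.le_iff.2 (Finset.union_subset
    (A.subset_ground.trans (Finset.sdiff_subset (s := E.set) (t := F.set))) h)

theorem exists_ofMinor_eq {H : M.Flat} (hFH : F ≤ H) (hHE : H ≤ E) :
    ∃ A : (M.minor F E h).Flat, ofMinor h A = H ∧ A.set = H.set \ F.set :=
  ⟨⟨H.set \ F.set, isFlat_minor_sdiff h hFH hHE⟩,
    Flat.ext (Finset.sdiff_union_of_subset hFH), rfl⟩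

theorem ofMinor_bot : ofMinor h ⊥ = F := by
  obtain ⟨A, hA, -⟩ := exists_ofMinor_eq h le_rfl h
  refine le_antisymm ?_ (le_ofMinor h ⊥)
  exact ((ofMinor h).le_iff_le.2 bot_le).trans hA.le

/-- Flats of the minor form the interval `[F, E]`; this is convex, so Möbius values agree, and the
rank of `F` cancels in the exponents. -/
theorem charPoly_minor :
    (M.minor F E h).charPoly = intervalChar (fun F : M.Flat => M.rk F.set) F E := by
  classical
  rw [charPoly, intervalChar]
  have himage : Finset.Icc F E = Finset.univ.map (ofMinor h).toEmbedding := by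
    ext H
    simp only [Finset.mem_Icc, Finset.mem_map, Finset.mem_univ, true_and,
      RelEmbedding.coe_toEmbedding]
    constructor
    · rintro ⟨h1, h2⟩
      obtain ⟨A, hA, -⟩ := exists_ofMinor_eq h h1 h2
      exact ⟨A, hA⟩
    · rintro ⟨A, rfl⟩
      exact ⟨le_ofMinor h A, ofMinor_le h A⟩
  rw [himage, Finset.sum_map]
  refine Finset.sum_congr rfl fun A _ => ?_
  congr 2
  · have := IncidenceAlgebra.mu_map (ofMinor h) (fun a x hax ⟨b, hb⟩ => by
      obtain ⟨A, hA, -⟩ := exists_ofMinor_eq h ((le_ofMinor h a).trans hax)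
        (hb.trans (ofMinor_le h b))
      exact ⟨A, hA⟩) ⊥ A
    rw [ofMinor_bot] at this
    convert this.symm using 2
    rfl
  · have h1 : (M.minor F E h).rk (M.minor F E h).ground = M.rk E.set - M.rk F.set := by
      change M.rk (E.set \ F.set ∪ F.set) - M.rk F.set = _
      rw [Finset.sdiff_union_of_subset (Flat.le_iff.1 h)]
    have h2 : (M.minor F E h).rk A.set = M.rk (A.set ∪ F.set) - M.rk F.set := rfl
    have h3 := M.rk_mono _ _ (le_ofMinor h A) (ofMinor h A).subset_ground
    have h4 := M.rk_mono _ _ (ofMinor_le h A) E.subset_ground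
    have h5 : (ofMinor h A).set = A.set ∪ F.set := rfl
    change M.rk F.set ≤ M.rk (ofMinor h A).set at h3
    change M.rk (ofMinor h A).set ≤ M.rk E.set at h4
    rw [h1, h2, RelEmbedding.coe_toEmbedding, ← h5]
    omega

variable {𝒢 : Set M.Flat}

theorem mem_minorBuilding {A : (M.minor F E h).Flat} :
    A ∈ minorBuilding 𝒢 F E h ↔ ∃ K ∈ 𝒢, K ≤ E ∧ ¬ K ≤ F ∧ ofMinor h A = K ⊔ F := by
  constructor
  · rintro ⟨G, ⟨K, hK, hKE, hGK⟩, hGF, hA⟩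
    refine ⟨K, hK, hKE, fun hKF => hGF ?_, ?_⟩
    · exact Flat.le_iff.2 (hGK.le.trans (Flat.le_iff.1 hKF))
    · rw [sup_set_restrict hGK (rfl : (F.toRestrict E h).set = F.set)] at hA
      apply Flat.ext
      refine (congrArg (· ∪ F.set) hA).trans ?_
      exact Finset.sdiff_union_of_subset (Flat.le_iff.1 (le_sup_right : F ≤ K ⊔ F))
  · rintro ⟨K, hK, hKE, hKF, hA⟩
    refine ⟨K.toRestrict E hKE, ⟨K, hK, hKE, rfl⟩, fun h' => hKF (Flat.le_iff.2 ?_), ?_⟩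
    · exact Flat.le_iff.1 h'
    · rw [sup_set_restrict (rfl : (K.toRestrict E hKE).set = K.set)
        (rfl : (F.toRestrict E h).set = F.set), ← hA, ofMinor_set]
      have hd : Disjoint A.set F.set :=
        Finset.disjoint_of_subset_left A.subset_ground Finset.sdiff_disjoint
      exact (Finset.union_sdiff_cancel_right hd).symm

open Classical in
-- The factors of the minor are the joins `K ⊔ F` with `K` a factor of `E` not below `F`. Both their
-- maximality and the injectivity of `K ↦ K ⊔ F` come from `key`.
theorem ncard_factors_minorBuilding
    (h𝒢 : IsRankedBuildingSet (fun F : M.Flat => M.rk F.set) 𝒢) :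
    (factors (minorBuilding 𝒢 F E h)).ncard =
      ((factorsFinset 𝒢 E).filter (¬ · ≤ F)).card := by
  have key : ∀ K ∈ factorsBelow 𝒢 E, ∀ K' ∈ factorsBelow 𝒢 E, ¬ K ≤ F → K ≤ K' ⊔ F → K = K' :=
    fun K hK K' hK' hKF hle => by
      by_contra hne
      exact hKF (h𝒢.le_of_le_sup E K hK K' hK' hne F h hle)
  have himage : ofMinor h '' factors (minorBuilding 𝒢 F E h) =
      (· ⊔ F) '' ((factorsFinset 𝒢 E).filter (¬ · ≤ F) : Finset M.Flat) := by
    ext H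
    simp only [Set.mem_image, Finset.coe_filter, mem_factorsFinset, Set.mem_ofPred_eq]
    constructor
    · rintro ⟨A, hA, rfl⟩
      obtain ⟨K, hK, hKE, hKF, hAK⟩ := (mem_minorBuilding h).1 hA.prop
      obtain ⟨K', hK', hle⟩ := exists_le_factor hK hKE
      have hK'F : ¬ K' ≤ F := fun h' => hKF (hle.trans h')
      refine ⟨K', ⟨hK', hK'F⟩, ?_⟩
      obtain ⟨B, hB, -⟩ := exists_ofMinor_eq h (le_sup_right : F ≤ K' ⊔ F)
        (sup_le hK'.prop.2 h)
      have hBm : B ∈ minorBuilding 𝒢 F E h :=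
        (mem_minorBuilding h).2 ⟨K', hK'.prop.1, hK'.prop.2, hK'F, hB⟩
      have hAB : A ≤ B := (ofMinor h).le_iff_le.1 (by
        rw [hAK, hB]
        exact sup_le_sup_right hle F)
      rw [← hB, hA.eq_of_le hBm hAB]
    · rintro ⟨K, ⟨hK, hKF⟩, rfl⟩
      obtain ⟨A, hA, -⟩ := exists_ofMinor_eq h (le_sup_right : F ≤ K ⊔ F) (sup_le hK.prop.2 h)
      refine ⟨A, ⟨(mem_minorBuilding h).2 ⟨K, hK.prop.1, hK.prop.2, hKF, hA⟩, fun B hB hAB => ?_⟩,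
        hA⟩
      obtain ⟨K1, hK1, hK1E, -, hBK⟩ := (mem_minorBuilding h).1 hB
      obtain ⟨K', hK', hle⟩ := exists_le_factor hK1 hK1E
      have h1 : K ⊔ F ≤ K1 ⊔ F := by
        rw [← hA, ← hBK]
        exact (ofMinor h).le_iff_le.2 hAB
      have h2 : K = K' := key K hK K' hK' hKF
        (le_sup_left.trans (h1.trans (sup_le_sup_right hle F)))
      refine (ofMinor h).le_iff_le.1 ?_
      rw [hA, hBK, h2]
      exact sup_le_sup_right hle F
  rw [← Set.ncard_image_of_injective _ (ofMinor h).injective, himage, Set.InjOn.ncard_image,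
    Set.ncard_coe_finset]
  intro K hK K' hK' heq
  simp only [Finset.coe_filter, mem_factorsFinset, Set.mem_ofPred_eq] at hK hK'
  exact key K hK.1 K' hK'.1 hK.2 (le_sup_left.trans (show K ⊔ F = K' ⊔ F from heq).le)

theorem intervalTerm_eq (h𝒢 : IsRankedBuildingSet (fun F : M.Flat => M.rk F.set) 𝒢) :
    M.intervalTerm 𝒢 F E h = intervalSeries (fun F : M.Flat => M.rk F.set) 𝒢 F E := by
  rw [intervalTerm, intervalSeries, charPoly_minor, ncard_factors_minorBuilding h h𝒢]

end Minor

end Polymatroid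

/-! ### The Hilbert series of the Chow ring -/

theorem familyIdeal_reindex {L σ τ A : Type*} [CompleteLattice L] [Fintype σ] [Fintype τ]
    [CommRing A] (r : L → ℕ) (e : σ ≃ τ) (g : τ → L) (T : Set L) (x : τ → A) :
    familyIdeal r (g ∘ e) T (x ∘ e) = familyIdeal r g T x := by
  classical
  have hrel : ∀ (S : Finset σ) (i : σ), familyRelation r (g ∘ e) T (x ∘ e) S i =
      familyRelation r g T x (S.map e.toEmbedding) (e i) := fun S i => by
    have hsum : upperSum (g ∘ e) (x ∘ e) (g (e i)) = upperSum g x (g (e i)) := by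
      simp only [upperSum, Finset.sum_filter]
      exact Equiv.sum_comp e fun j => if g (e i) ≤ g j then x j else 0
    have himage : (g ∘ e) '' (S : Set σ) = g '' (S.map e.toEmbedding : Finset τ) := by
      rw [Finset.coe_map, Set.image_comp]
      rfl
    rw [familyRelation, familyRelation, Function.comp_apply, hsum, himage, Finset.prod_map]
    rfl
  rw [familyIdeal, familyIdeal]
  congr 1
  ext y
  constructor
  · rintro ⟨⟨S, i⟩, rfl⟩
    exact ⟨(S.map e.toEmbedding, e i), (hrel S i).symm⟩
  · rintro ⟨⟨S, i⟩, rfl⟩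
    refine ⟨(S.map e.symm.toEmbedding, e.symm i), ?_⟩
    dsimp only
    rw [hrel]
    simp [Finset.map_map]

theorem familySeries_eq_standardSeries {L : Type*} [CompleteLattice L] [Fintype L] (r : L → ℕ)
    {n : ℕ} {g : Fin n → L} (hg : Function.Injective g) :
    familySeries r g ∅ = standardSeries r (Set.range g) ⊤ := by
  classical
  refine Finset.sum_bij (fun S _ => S.map ⟨g, hg⟩) ?_ ?_ ?_ ?_
  · intro S _
    rw [Finset.mem_powerset]
    intro G hG
    obtain ⟨i, -, rfl⟩ := Finset.mem_map.1 hG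
    exact mem_buildingFinset.2 ⟨⟨i, rfl⟩, le_top⟩
  · intro S _ S' _ h
    exact Finset.map_injective _ h
  · intro S hS
    refine ⟨Finset.univ.filter fun i => g i ∈ S, Finset.mem_univ _, ?_⟩
    ext G
    simp only [Finset.mem_map, Finset.mem_filter, Finset.mem_univ, true_and,
      Function.Embedding.coeFn_mk]
    constructor
    · rintro ⟨i, hi, rfl⟩
      exact hi
    · intro hG
      obtain ⟨⟨i, rfl⟩, -⟩ := mem_buildingFinset.1 (Finset.mem_powerset.1 hS hG)
      exact ⟨i, hG, rfl⟩
  · intro S _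
    rw [supportSeries, Finset.prod_map, Finset.coe_map]
    simp only [Set.forall_mem_range, Set.union_empty, Function.Embedding.coeFn_mk]

namespace Polymatroid

variable {α : Type*} [DecidableEq α] {M : Polymatroid α} {𝒢 : Set M.Flat}

theorem supBelow_eq_supLT (S : Finset 𝒢) (G : 𝒢) :
    supBelow S G = supLT (Subtype.val '' (S : Set 𝒢) ∪ ∅) G.1 := by
  rw [Set.union_empty, supBelow, supLT, ← sSup_image]
  congr 1
  ext K
  constructor
  · rintro ⟨K, ⟨h1, h2⟩, rfl⟩
    exact ⟨⟨K, h1, rfl⟩, h2⟩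
  · rintro ⟨⟨K, h1, rfl⟩, h2⟩
    exact ⟨K, ⟨h1, h2⟩, rfl⟩

open Classical in
theorem chowIdeal_eq_familyIdeal :
    M.chowIdeal 𝒢 = familyIdeal (fun F : M.Flat => M.rk F.set) (Subtype.val : 𝒢 → M.Flat) ∅
      (MvPolynomial.X : 𝒢 → MvPolynomial 𝒢 ℚ) := by
  rw [chowIdeal, familyIdeal]
  congr 2
  funext ⟨S, G⟩
  dsimp only
  rw [chowRelation, familyRelation, relRank, upperSum, supBelow_eq_supLT]
  congr!

open MvPolynomial in
theorem homogeneousComponent_mem_chowIdeal (n : ℕ) {p : MvPolynomial 𝒢 ℚ}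
    (hp : p ∈ M.chowIdeal 𝒢) : homogeneousComponent n p ∈ M.chowIdeal 𝒢 := by
  classical
  let _ := MvPolynomial.gradedAlgebra (σ := 𝒢) (R := ℚ)
  refine (mem_iff_homogeneousComponent_mem (Ideal.homogeneous_span _ _ ?_) p).1 hp n
  rintro _ ⟨⟨S, G⟩, rfl⟩
  refine ⟨_, IsHomogeneous.mul (IsHomogeneous.prod S _ _ fun G' _ => isHomogeneous_X ℚ G')
    ((IsHomogeneous.sum _ _ _ fun H _ => isHomogeneous_X ℚ H).pow _)⟩

/-- Sorting `𝒢` by rank gives a ranked family, with closure under joins supplied by `sup_mem`; the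
result is transported back along the enumeration. -/
theorem hasHilbertSeries_chowIdeal (hM : M.Loopless) (h𝒢 : M.IsBuildingSet 𝒢) :
    HasHilbertSeries (M.chowIdeal 𝒢) (standardSeries (fun F : M.Flat => M.rk F.set) 𝒢 ⊤) := by
  classical
  set r := fun F : M.Flat => M.rk F.set
  let e₀ : Fin (Fintype.card 𝒢) ≃ 𝒢 := (Fintype.equivFin 𝒢).symm
  let e : Fin (Fintype.card 𝒢) ≃ 𝒢 := (Tuple.sort fun i => r (e₀ i).1).trans e₀
  let g : Fin (Fintype.card 𝒢) → M.Flat := Subtype.val ∘ e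
  have hrange : Set.range g = 𝒢 := by
    rw [Set.range_comp, e.range_eq_univ, Set.image_univ, Subtype.range_coe]
  have hg : IsRankedFamily r g :=
    { injective := Subtype.val_injective.comp e.injective
      ne_bot := fun i => h𝒢.ne_bot hM (e i).2
      mono := Tuple.monotone_sort fun i => r (e₀ i).1
      closed := fun i j hij => by
        exact hrange.ge (h𝒢.sup_mem (e i).2 (e j).2 hij) }
  have h := hasHilbertSeries_familyIdeal (isRankFunction hM) hg ∅
  rw [familySeries_eq_standardSeries r hg.injective, hrange] at h
  have hIJ : ∀ (x : 𝒢 → MvPolynomial 𝒢 ℚ), x = MvPolynomial.X →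
      M.chowIdeal 𝒢 = familyIdeal r (Subtype.val : 𝒢 → M.Flat) ∅ x := by
    rintro _ rfl
    rw [chowIdeal_eq_familyIdeal]
  have hX : (MvPolynomial.X ∘ e.symm) ∘ e =
      (MvPolynomial.X : Fin (Fintype.card 𝒢) → MvPolynomial (Fin (Fintype.card 𝒢)) ℚ) := by
    funext i
    simp
  rw [← hX, familyIdeal_reindex r e Subtype.val ∅] at h
  refine h.rename e fun p => ⟨fun hp => ?_, fun hp => ?_⟩
  · rw [hIJ _ rfl] at hp
    have := Ideal.mem_map_of_mem (RingHomClass.toRingHom (MvPolynomial.rename (R := ℚ) e.symm)) hp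
    rw [map_familyIdeal] at this
    convert this using 2
    · funext G
      simp
    · rfl
  · have := Ideal.mem_map_of_mem (RingHomClass.toRingHom (MvPolynomial.rename (R := ℚ) e)) hp
    rw [map_familyIdeal, ← hIJ _ (by funext G; simp)] at this
    simpa [MvPolynomial.rename_rename] using this

theorem hilbertSeries_eq (hM : M.Loopless) (h𝒢 : M.IsBuildingSet 𝒢) :
    M.hilbertSeries 𝒢 = standardSeries (fun F : M.Flat => M.rk F.set) 𝒢 ⊤ := by
  ext n
  rw [hilbertSeries, PowerSeries.coeff_mk]
  exact (hasHilbertSeries_chowIdeal hM h𝒢).finrank_eq n fun p hp =>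
    homogeneousComponent_mem_chowIdeal n hp

theorem sum_flatChain (hM : M.Loopless)
    (h𝒢 : IsRankedBuildingSet (fun F : M.Flat => M.rk F.set) 𝒢) (m : ℕ) :
    ∑ c : M.FlatChain m, (-1 : PowerSeries ℚ) ^ m *
        ∏ i : Fin m, M.intervalTerm 𝒢 (c.1 i.castSucc) (c.1 i.succ) (c.step_le i) =
      chainSum (intervalSeries (fun F : M.Flat => M.rk F.set) 𝒢) m ⊤ := by
  refine Finset.sum_bij (fun c _ => c.1) ?_ ?_ ?_ ?_
  · intro c _
    refine mem_chainsTo.2 ⟨c.2.1, Flat.ext ?_, Flat.ext ?_⟩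
    · rw [c.2.2.1, hM.bot_set]
    · rw [c.2.2.2, top_set]
  · intro c _ c' _ h
    exact Subtype.ext h
  · intro c hc
    obtain ⟨h1, h2, h3⟩ := mem_chainsTo.1 hc
    exact ⟨⟨c, h1, by rw [h2, hM.bot_set], by rw [h3, top_set]⟩, Finset.mem_univ _, rfl⟩
  · intro c _
    simp only [intervalTerm_eq _ h𝒢]

/-- Cardinality rather than rank is the height function for the chain recursion, so that the sum
over lengths stops at the size of the ground set. -/
theorem strictMono_card : StrictMono fun F : M.Flat => F.set.card := fun _ _ h =>
  Finset.card_lt_card (Finset.ssubset_iff_subset_ne.2 ⟨h.le, fun h' => h.ne (Flat.ext h')⟩)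

end Polymatroid

/-- The sum over all chains of flats of all lengths `m`; a strict chain of subsets of the ground set
`E` that starts with the empty set has `m ≤ |E|`. -/
theorem corollary1p2 {α : Type*} [DecidableEq α] (M : Polymatroid α) (hM : M.Loopless)
    (𝒢 : Set M.Flat) (h𝒢 : M.IsBuildingSet 𝒢) :
    M.hilbertSeries 𝒢 =
      ∑ m ∈ Finset.range (M.ground.card + 1), ∑ c : M.FlatChain m,
        (-1 : PowerSeries ℚ) ^ m *
          ∏ i : Fin m, M.intervalTerm 𝒢 (c.1 i.castSucc) (c.1 i.succ) (c.step_le i) := by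
  have hr := Polymatroid.isRankFunction hM
  have h𝒢' := h𝒢.isRankedBuildingSet hM
  rw [Polymatroid.hilbertSeries_eq hM h𝒢, Finset.sum_congr rfl fun m _ => Polymatroid.sum_flatChain hM h𝒢' m]
  exact eq_sum_chainSum _ _ _ Polymatroid.strictMono_card (standardSeries_bot hr h𝒢')
    (fun E hE => standardSeries_rec hr h𝒢' hE) _ _
    (Finset.card_le_card (⊤ : M.Flat).subset_ground)
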